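/- Let $P\subset\mathbb R^2$ be a convex polygon with vertices $A_1,\dots,A_n$ ($n\ge 3$), let $\theta_{\min}$ be its minimal vertex angle, and let $\mathcal S=\{S_1,\dots,S_m\}$ be a polygonal tree system associated with $P$: the $S_i$ are contracting similarities of the plane (with ratios in $(0,1)$) such that, with $P_i=S_i(P)$, (D1) $P_i\subset P$ for all $i$; (D2) for $i\ne j$ the set $P_i\cap P_j$ is empty or consists of one point, which is a common vertex of $P_i$ and $P_j$; (D3) each vertex $A_k$ lies in some $P_i$; (D4) $\bigcup_{i=1}^m P_i$ is contractible. Let $K$ be the attractor of $\mathcal S$, that is, the non-empty compact set with $K=\bigcup_{i=1}^m S_i(K)$. Let $\hat\gamma$ be the main tree of $K$: the union, over all $i\neq j$, of the arc in $K$ joining $A_i$ and $A_j$. Write $S_{\mathbf i}=S_{i_1}\circ\dots\circ S_{i_k}$ for a multiindex $\mathbf i=i_1\dots i_k$, $k\ge 1$, and let $Ord(p,X)$ be the Menger–Urysohn order of $X$ at $p$, that is, the least $k$ such that $p$ has arbitrarily small open neighbourhoods in $X$ whose boundary in $X$ has at most $k$ points. Let $y$ be a cut point of $K$, that is, a point such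 that $K\setminus\{y\}$ is not connected. Then there are a multiindex $\mathbf i$ and a point $x\in\hat\gamma$ such that $y=S_{\mathbf i}(x)$ and such that, if $x$ is not a vertex of $P$, then $Ord(y,K)=Ord(x,\hat\gamma)$. Moreover, whenever $y=S_{\mathbf i}(x)$ for some multiindex $\mathbf i$ and some vertex $x$ of $P$ (in particular if the point $x$ found above is a vertex), there are multiindices $\mathbf i_1,\dots,\mathbf i_s$ and vertices $x_1,\dots,x_s$ of $P$ such that $S_{\mathbf i_k}(x_k)=y$ for every $k$, $S_{\mathbf i_k}(P)\cap S_{\mathbf i_l}(P)=\{y\}$ for all $k\ne l$, and $$Ord(y,K)=\sum_{k=1}^s Ord(x_k,\hat\gamma)\le (n-1)\left(\left\lceil\frac{2\pi}{\theta_{\min}}\right\rceil-1\right).$$ -/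

import Mathlib

open Set Topology

/-- The Euclidean plane. -/
abbrev Plane : Type := EuclideanSpace ℝ (Fin 2)

/-- A similarity of the plane with some ratio `0 < r < 1`. -/
def IsContractingSimilarity (f : Plane → Plane) : Prop :=
  ∃ r : ℝ, 0 < r ∧ r < 1 ∧ ∀ x y, dist (f x) (f y) = r * dist x y

/-- `A 0, …, A (n - 1)` are the vertices of a convex polygon, listed in cyclic order (in either
direction): there are at least three of them, none lies in the convex hull of the others, and
consecutive ones are joined by a side. The indices are taken modulo `n`. -/
structure IsConvexPolygon {n : ℕ} [NeZero n] (A : Fin n → Plane) : Prop where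
  three_le : 3 ≤ n
  convexIndependent : ConvexIndependent ℝ A
  side : ∀ i, segment ℝ (A i) (A (i + 1)) ⊆ frontier (convexHull ℝ (range A))

/-- The (closed, filled) polygon with the vertices `A i`. -/
def polygon {n : ℕ} (A : Fin n → Plane) : Set Plane := convexHull ℝ (range A)

/-- The angle of the polygon at the vertex `A i`, that is, between the two sides meeting there. -/
noncomputable def vertexAngle {n : ℕ} [NeZero n] (A : Fin n → Plane) (i : Fin n) : ℝ :=
  EuclideanGeometry.angle (A (i - 1)) (A i) (A (i + 1))

/-- The minimal vertex angle of the polygon. -/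
noncomputable def minVertexAngle {n : ℕ} [NeZero n] (A : Fin n → Plane) : ℝ :=
  ⨅ i, vertexAngle A i

/-- `S` is a polygonal tree system associated with the convex polygon with the vertices `A i`. -/
structure IsPolygonalTreeSystem {n m : ℕ} [NeZero n] (A : Fin n → Plane)
    (S : Fin m → Plane → Plane) : Prop where
  isConvexPolygon : IsConvexPolygon A
  isContractingSimilarity : ∀ i, IsContractingSimilarity (S i)
  /-- (D1) -/
  subset : ∀ i, S i '' polygon A ⊆ polygon A
  /-- (D2) -/
  inter : ∀ i j, i ≠ j → S i '' polygon A ∩ S j '' polygon A = ∅ ∨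
    ∃ a b, S i (A a) = S j (A b) ∧ S i '' polygon A ∩ S j '' polygon A = {S i (A a)}
  /-- (D3) -/
  vertex_mem : ∀ a, ∃ i, A a ∈ S i '' polygon A
  /-- (D4) -/
  contractible : ContractibleSpace (⋃ i, S i '' polygon A : Set Plane)

/-- `K` is the attractor (the invariant set) of the system `S`. -/
structure IsAttractor {m : ℕ} (S : Fin m → Plane → Plane) (K : Set Plane) : Prop where
  nonempty : K.Nonempty
  isCompact : IsCompact K
  invariant : K = ⋃ i, S i '' K

/-- The composition `S_w = S_{j₁} ∘ ⋯ ∘ S_{jₖ}` for a multiindex `w = j₁ ⋯ jₖ`. -/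
def wordMap {m : ℕ} (S : Fin m → Plane → Plane) : List (Fin m) → Plane → Plane
  | [] => id
  | j :: w => S j ∘ wordMap S w

/-- `L` is a Jordan arc with the end points `a` and `b`. -/
def IsJordanArc (a b : Plane) (L : Set Plane) : Prop :=
  ∃ g : unitInterval → Plane, Continuous g ∧ Function.Injective g ∧ g 0 = a ∧ g 1 = b ∧ range g = L

/-- The main tree of `K`: the union, over all pairs of different vertices `A i`, `A j`, of the arc
in `K` with these end points. (In a dendrite there is exactly one such arc.) -/
def mainTree {n : ℕ} (A : Fin n → Plane) (K : Set Plane) : Set Plane :=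
  {x | ∃ i j, i ≠ j ∧ ∃ L, IsJordanArc (A i) (A j) L ∧ L ⊆ K ∧ x ∈ L}

/-- `p` is a cut point of the space `X`: `X ∖ {p}` is not connected. -/
def IsCutPoint {X : Type*} [TopologicalSpace X] (p : X) : Prop :=
  ¬ IsPreconnected ({p}ᶜ : Set X)

/-- The Menger–Urysohn order of the space `X` at the point `p`: the least `k` such that `p` has
arbitrarily small open neighbourhoods whose boundary has at most `k` points. All infinite orders are
recorded as `⊤`. -/
noncomputable def mengerOrder {X : Type*} [TopologicalSpace X] (p : X) : ℕ∞ :=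
  sInf {k : ℕ∞ | ∀ U ∈ 𝓝 p, ∃ V ⊆ U, IsOpen V ∧ p ∈ V ∧ (frontier V).encard ≤ k}

/-!
Let `X = K` and write `comp(x)` for the set of components of `X ∖ {x}`. The proof rests on the
equality `mengerOrder x = |comp(x)|` and on the way in which components are distributed over the
pieces `S_w(K)` of a fixed level.

*Lower bounds.* Disjoint connected sets that accumulate at `x` without containing it all meet the
boundary of every small neighbourhood of `x` (`card_le_mengerOrder`). As `K` is connected and
locally connected, the members of `comp(x)` are such sets.

*Upper bounds.* The contractibility of the union of the polygons enters only through the lifting of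
maps to the circle: functions on the pieces that agree modulo integers at the common points can be
made to agree by adding integers (`IsPolygonalTreeSystem.exists_integers`). By induction on the
level the same holds for `K` and its pieces of any level (`IsSelfSimilarTree.exists_lift`). Hence
there are no cycles of pieces: a connected union of pieces avoiding `x` meets the union of the
pieces through `x` in at most one point (`IsSelfSimilarTree.subsingleton_inter_star`). So each
component of `X ∖ {x}` can be cut off at a single point arbitrarily close to `x`, and the order is
at most `|comp(x)|`, once this is finite.

*Sums.* Let `S_{v_1}(K), …, S_{v_s}(K)` be the pieces of a high level `k` that contain `y`, and
`y = S_{v_i}(z_i)`. The images of the components of the sets `K ∖ {z_i}` are disjoint, connected and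
accumulate at `y`, so there are at most `mengerOrder y` of them. On the other hand a component of
`K ∖ {y}` is not contained in the union of these pieces if `k` is large, so it contains the image
of a vertex under some `S_{v_i}`, and with it the image of a component of `K ∖ {z_i}`. So these
components correspond bijectively to those of `K ∖ {y}`, which gives the sum formula and moreover
shows that each component of `K ∖ {z_i}` contains a vertex
(`IsSelfSimilarTree.exists_forall_mengerOrder_eq_sum`). The argument needs a bound for `s` that
does not depend on `k`; it comes from the angles: if `s ≥ 2`, the pieces meet only at their common
vertex `y` and occupy disjoint closed arcs of directions there
(`IsPolygonalTreeSystem.ncard_wordsThrough_le`).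

*The main tree.* If each component of `K ∖ {z}` contains a vertex and misses another one, an arc
between two such vertices runs through `z` and ends in the component; so the lower bound above,
applied to the ends of these arcs, shows that `z` has the same order in the main tree as in `K`
(`IsPolygonalTreeSystem.mengerOrder_mainTree_eq`). This applies to the `z_i` if they are vertices;
there are then at most `n - 1` components. If they are not, there is only one of them, and it
applies when `y` is a cut point. The arcs are constructed as fixed points: the arcs between
vertices have to be composed of small copies of each other along shortest chains of pieces
(`IsSelfSimilarTree.exists_arc`).
-/

/-! ### Components of the complement of a point and the Menger–Urysohn order -/

section MengerOrder

variable {X : Type*} [TopologicalSpace X]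

/-- The components of `X ∖ {p}`, as subsets of `X`. -/
def complComponents (p : X) : Set (Set X) := connectedComponentIn {p}ᶜ '' {p}ᶜ

namespace complComponents

variable {p : X} {C D s : Set X}

theorem isPreconnected (hC : C ∈ complComponents p) : IsPreconnected C := by
  obtain ⟨x, -, rfl⟩ := hC
  exact isPreconnected_connectedComponentIn

theorem nonempty (hC : C ∈ complComponents p) : C.Nonempty := by
  obtain ⟨x, hx, rfl⟩ := hC
  exact ⟨x, mem_connectedComponentIn hx⟩

theorem subset_compl (hC : C ∈ complComponents p) : C ⊆ {p}ᶜ := by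
  obtain ⟨x, -, rfl⟩ := hC
  exact connectedComponentIn_subset _ _

theorem notMem (hC : C ∈ complComponents p) : p ∉ C := fun h => subset_compl hC h rfl

theorem exists_mem {x : X} (hx : x ≠ p) : ∃ C ∈ complComponents p, x ∈ C :=
  ⟨_, mem_image_of_mem _ hx, mem_connectedComponentIn hx⟩

theorem eq_connectedComponentIn (hC : C ∈ complComponents p) {x : X} (hx : x ∈ C) :
    C = connectedComponentIn {p}ᶜ x := by
  obtain ⟨y, -, rfl⟩ := hC
  exact connectedComponentIn_eq hx

theorem subset_of_isPreconnected (hC : C ∈ complComponents p) (hs : IsPreconnected s)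
    (hsp : p ∉ s) {x : X} (hxs : x ∈ s) (hxC : x ∈ C) : s ⊆ C := by
  rw [eq_connectedComponentIn hC hxC]
  exact hs.subset_connectedComponentIn hxs (subset_compl_singleton_iff.2 hsp)

theorem eq_of_mem (hC : C ∈ complComponents p) (hD : D ∈ complComponents p) {x : X} (hxC : x ∈ C)
    (hxD : x ∈ D) : C = D := by
  rw [eq_connectedComponentIn hC hxC, eq_connectedComponentIn hD hxD]

theorem exists_superset (hs : IsPreconnected s) (hne : s.Nonempty) (hsp : p ∉ s) :
    ∃ C ∈ complComponents p, s ⊆ C := by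
  obtain ⟨x, hx⟩ := hne
  obtain ⟨C, hC, hxC⟩ := exists_mem (p := p) (x := x) fun h => hsp (h ▸ hx)
  exact ⟨C, hC, subset_of_isPreconnected hC hs hsp hx hxC⟩

/-- In a connected, locally connected space every component of `X ∖ {p}` has `p` in its closure:
otherwise it would be open and closed in `X`. -/
theorem mem_closure [T1Space X] [PreconnectedSpace X] [LocallyConnectedSpace X]
    (hC : C ∈ complComponents p) : p ∈ closure C := by
  by_contra hp
  have hclosed : IsClosed C := by
    obtain ⟨x, hx⟩ := nonempty hC
    exact closure_subset_iff_isClosed.1 <| subset_of_isPreconnected hC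
      (isPreconnected hC).closure hp (subset_closure hx) hx
  have hopen : IsOpen C := by
    obtain ⟨x, -, rfl⟩ := hC
    exact isOpen_compl_singleton.connectedComponentIn
  have := IsClopen.eq_univ ⟨hclosed, hopen⟩ (nonempty hC)
  exact notMem hC (this ▸ mem_univ p)

theorem two_le_encard (hp : IsCutPoint p) : 2 ≤ (complComponents p).encard := by
  have hne : (({p}ᶜ : Set X)).Nonempty := by
    by_contra h
    exact hp (not_nonempty_iff_eq_empty.1 h ▸ isPreconnected_empty)
  obtain ⟨x, hx⟩ := hne
  have h2 : ∃ y, y ≠ p ∧ y ∉ connectedComponentIn {p}ᶜ x := by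
    by_contra! h
    refine hp ?_
    have : ({p}ᶜ : Set X) = connectedComponentIn {p}ᶜ x :=
      Subset.antisymm (fun y hy => h y hy) (connectedComponentIn_subset _ _)
    rw [this]
    exact isPreconnected_connectedComponentIn
  obtain ⟨y, hy, hyx⟩ := h2
  have hne : connectedComponentIn {p}ᶜ x ≠ connectedComponentIn {p}ᶜ y := fun h =>
    hyx (h ▸ mem_connectedComponentIn hy)
  rw [← encard_pair hne]
  exact encard_le_encard <| insert_subset (mem_image_of_mem _ hx)
    (singleton_subset_iff.2 (mem_image_of_mem _ hy))

end complComponents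

/-- Disjoint connected sets that accumulate at `p` without containing it bound the order at `p`
from below: each of them meets the boundary of every sufficiently small neighbourhood of `p`. -/
theorem card_le_mengerOrder [T1Space X] {ι : Type*} [Finite ι] {p : X} {C : ι → Set X}
    (hC : ∀ i, IsPreconnected (C i)) (hp : ∀ i, p ∉ C i) (hcl : ∀ i, p ∈ closure (C i))
    (hdisj : ∀ i j x, x ∈ C i → x ∈ C j → i = j) : ENat.card ι ≤ mengerOrder p := by
  refine le_sInf fun k hk => ?_
  have hne : ∀ i, (C i).Nonempty := fun i => closure_nonempty_iff.1 ⟨p, hcl i⟩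
  choose c hc using hne
  have hU : (range c)ᶜ ∈ 𝓝 p := by
    refine (finite_range c).isClosed.isOpen_compl.mem_nhds ?_
    rintro ⟨i, hi⟩
    exact hp i (hi ▸ hc i)
  obtain ⟨V, hVU, hVo, hpV, hVk⟩ := hk _ hU
  have hfr : ∀ i, ∃ x, x ∈ C i ∩ frontier V := fun i => by
    obtain ⟨x, hxV, hxC⟩ := mem_closure_iff.1 (hcl i) V hVo hpV
    by_contra! hfr
    have hsub : C i ⊆ V ∪ (closure V)ᶜ := fun z hz => by
      by_contra! h
      rw [mem_union, not_or, mem_compl_iff, not_not] at h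
      exact hfr z ⟨hz, by rw [hVo.frontier_eq]; exact ⟨h.2, h.1⟩⟩
    obtain ⟨z, -, hzV, hz⟩ := hC i V (closure V)ᶜ hVo isClosed_closure.isOpen_compl hsub
      ⟨x, hxC, hxV⟩ ⟨c i, hc i, fun h => (hsub (hc i)).elim
        (fun hV => hVU hV (mem_range_self i)) fun h' => h' h⟩
    exact hz (subset_closure hzV)
  choose f hf using hfr
  have hinj : Function.Injective fun i => (⟨f i, (hf i).2⟩ : frontier V) := fun i j hij => by
    have : f i = f j := congrArg Subtype.val hij
    exact hdisj i j (f i) (hf i).1 (this ▸ (hf j).1)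
  exact (ENat.card_le_card_of_injective hinj).trans hVk

theorem Topology.IsInducing.mengerOrder_le {Y : Type*} [TopologicalSpace Y] {f : Y → X}
    (hf : IsInducing f) (hinj : Function.Injective f) (y : Y) :
    mengerOrder y ≤ mengerOrder (f y) := by
  refine le_sInf fun k hk => sInf_le fun U hU => ?_
  rw [hf.nhds_eq_comap] at hU
  obtain ⟨U', hU', hUU⟩ := hU
  obtain ⟨V, hVU, hVo, hyV, hVk⟩ := hk U' hU'
  refine ⟨f ⁻¹' V, (preimage_mono hVU).trans hUU, hVo.preimage hf.continuous, hyV, ?_⟩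
  refine le_trans ?_ hVk
  refine (encard_le_encard (hf.continuous.frontier_preimage_subset V)).trans ?_
  rw [← hinj.encard_image]
  exact encard_le_encard (image_preimage_subset _ _)
end MengerOrder

/-- Continuity can be checked on the members of a finite cover by images of a compact space. -/
theorem continuous_of_finite_compact_cover {ι Y X Z : Type*} [Finite ι] [TopologicalSpace Y]
    [CompactSpace Y] [TopologicalSpace X] [T2Space X] [TopologicalSpace Z] {p : ι → Y → X}
    (hp : ∀ i, Continuous (p i)) (hcov : ∀ x, ∃ i y, p i y = x) {f : X → Z}
    (hf : ∀ i, Continuous fun y => f (p i y)) : Continuous f := by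
  refine continuous_iff_isClosed.2 fun T hT => ?_
  have : f ⁻¹' T = ⋃ i, p i '' ((fun y => f (p i y)) ⁻¹' T) := by
    ext x
    simp only [mem_preimage, mem_iUnion, mem_image]
    constructor
    · intro hx
      obtain ⟨i, y, rfl⟩ := hcov x
      exact ⟨i, y, hx, rfl⟩
    · rintro ⟨i, y, hy, rfl⟩
      exact hy
  rw [this]
  exact isClosed_iUnion_of_finite fun i =>
    ((hT.preimage (hf i)).isCompact.image (hp i)).isClosed

/-- A continuous function on a connected set that differs from another one by integers only
differs from it by a constant. -/
theorem IsPreconnected.sub_eq_sub_of_coe_eq {X : Type*} [TopologicalSpace X] {s : Set X}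
    (hs : IsPreconnected s) {f g : X → ℝ} (hf : ContinuousOn f s) (hg : ContinuousOn g s)
    (hfg : ∀ x ∈ s, (f x : AddCircle (1 : ℝ)) = g x) {x y : X} (hx : x ∈ s) (hy : y ∈ s) :
    f x - g x = f y - g y := by
  refine hs.constant_of_mapsTo Int.isClosedEmbedding_coe_real.isInducing.isDiscrete_range
    (f := fun x => f x - g x) (hf.sub hg) (fun x hx => ?_) hx hy
  have h := hfg x hx
  rw [← sub_eq_zero, ← AddCircle.coe_sub, AddCircle.coe_eq_zero_iff] at h
  obtain ⟨n, hn⟩ := h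
  exact ⟨n, by simpa using hn⟩

/-! ### Words and self-similar trees -/

section SelfSimilarTree

variable {X ι : Type*}

/-- The composition `σ_w = σ_{i₁} ∘ ⋯ ∘ σ_{iₖ}` for a word `w = i₁ ⋯ iₖ`. -/
def wordComp (σ : ι → X → X) : List ι → X → X
  | [] => id
  | i :: w => σ i ∘ wordComp σ w

/-- The words `w` of length `k` whose piece `σ_w(X)` contains `y`. -/
def wordsThrough (σ : ι → X → X) (k : ℕ) (y : X) : Set (List ι) :=
  {w | w.length = k ∧ y ∈ range (wordComp σ w)}

/-- The union of the pieces of level `k` that contain `y`. -/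
def pieceStar (σ : ι → X → X) (k : ℕ) (y : X) : Set X :=
  ⋃ w ∈ wordsThrough σ k y, range (wordComp σ w)

/-- The union of the pieces of level `k` that do not contain `y`. -/
def pieceCostar (σ : ι → X → X) (k : ℕ) (y : X) : Set X :=
  ⋃ w ∈ {w : List ι | w.length = k ∧ y ∉ range (wordComp σ w)}, range (wordComp σ w)

theorem wordComp_append (σ : ι → X → X) (u v : List ι) :
    wordComp σ (u ++ v) = wordComp σ u ∘ wordComp σ v := by
  induction u with
  | nil => rfl
  | cons i u ih => rw [List.cons_append, wordComp, ih, wordComp, Function.comp_assoc]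

/-- Injective maps `σ i` whose images meet, pairwise, in at most one point, which is the image of
a point of the vertex set `V` under both maps; only vertices are mapped to vertices. -/
structure MeetsInVertices (σ : ι → X → X) (V : Set X) : Prop where
  injective : ∀ i, Function.Injective (σ i)
  mem_of_eq : ∀ i j x x', i ≠ j → σ i x = σ j x' → x ∈ V
  eq_of_eq : ∀ i j x x' z z', i ≠ j → σ i x = σ j x' → σ i z = σ j z' → x = z
  mem_of_map_mem : ∀ i x, σ i x ∈ V → x ∈ V

namespace MeetsInVertices

variable {σ : ι → X → X} {V : Set X}

theorem injective_wordComp (h : MeetsInVertices σ V) (w : List ι) :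
    Function.Injective (wordComp σ w) := by
  induction w with
  | nil => exact Function.injective_id
  | cons i w ih => exact (h.injective i).comp ih

theorem mem_of_wordComp_mem (h : MeetsInVertices σ V) {w : List ι} {x : X}
    (hx : wordComp σ w x ∈ V) : x ∈ V := by
  induction w with
  | nil => exact hx
  | cons i w ih => exact ih (h.mem_of_map_mem i _ hx)

theorem mem_of_wordComp_eq (h : MeetsInVertices σ V) {v w : List ι} (hlen : v.length = w.length)
    (hne : v ≠ w) {x x' : X} (hx : wordComp σ v x = wordComp σ w x') : x ∈ V := by
  induction v generalizing w with
  | nil => exact absurd (List.length_eq_zero_iff.1 hlen.symm).symm hne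
  | cons i v ih =>
    obtain _ | ⟨j, w⟩ := w
    · simp at hlen
    by_cases hij : i = j
    · subst hij
      exact ih (by simpa using hlen) (fun h' => hne (by rw [h'])) (h.injective i hx)
    · exact h.mem_of_wordComp_mem (h.mem_of_eq i j _ _ hij hx)

theorem eq_of_wordComp_eq (h : MeetsInVertices σ V) {v w : List ι} (hlen : v.length = w.length)
    (hne : v ≠ w) {x x' z z' : X} (hx : wordComp σ v x = wordComp σ w x')
    (hz : wordComp σ v z = wordComp σ w z') : x = z := by
  induction v generalizing w with
  | nil => exact absurd (List.length_eq_zero_iff.1 hlen.symm).symm hne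
  | cons i v ih =>
    obtain _ | ⟨j, w⟩ := w
    · simp at hlen
    by_cases hij : i = j
    · subst hij
      exact ih (by simpa using hlen) (fun h' => hne (by rw [h'])) (h.injective i hx)
        (h.injective i hz)
    · exact h.injective_wordComp v (h.eq_of_eq i j _ _ _ _ hij hx hz)

end MeetsInVertices

/-- The structure of the attractor of a polygonal tree system, detached from the plane: injective
contractions `σ i` whose images cover `X`, meet only in images of the finite vertex set `V`, in at
most one point each, and are arranged like a tree. The last property is
expressed by `connected` (the intersection graph is connected) and `lift` (a system of real
functions on the pieces that fit together modulo integers fits together after adding integers to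
them: the first cohomology of the arrangement vanishes). -/
structure IsSelfSimilarTree [MetricSpace X] (σ : ι → X → X) (V : Set X) : Prop
    extends MeetsInVertices σ V where
  finite : V.Finite
  contracting : ∃ ρ : ℝ, 0 ≤ ρ ∧ ρ < 1 ∧ ∀ i x y, dist (σ i x) (σ i y) ≤ ρ * dist x y
  exists_eq : ∀ x, ∃ i x', σ i x' = x
  connected : ∀ c : ι → Prop, (∀ i j x x', σ i x = σ j x' → (c i ↔ c j)) → ∀ i j, c i ↔ c j
  lift : ∀ h : ι → C(X, ℝ),
    (∀ i j x x', σ i x = σ j x' → (h i x : AddCircle (1 : ℝ)) = h j x') →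
    ∃ c : ι → ℤ, ∀ i j x x', σ i x = σ j x' → h i x + c i = h j x' + c j

namespace IsSelfSimilarTree

variable [MetricSpace X] {σ : ι → X → X} {V : Set X}

theorem continuous (h : IsSelfSimilarTree σ V) (i : ι) : Continuous (σ i) := by
  obtain ⟨ρ, h0, -, hρ⟩ := h.contracting
  exact (LipschitzWith.of_dist_le_mul (K := ⟨ρ, h0⟩) (hρ i)).continuous

theorem continuous_wordComp (h : IsSelfSimilarTree σ V) (w : List ι) :
    Continuous (wordComp σ w) := by
  induction w with
  | nil => exact continuous_id
  | cons i w ih => exact (h.continuous i).comp ih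

theorem exists_wordComp_eq (h : IsSelfSimilarTree σ V) (k : ℕ) (x : X) :
    ∃ w : List ι, w.length = k ∧ ∃ x', wordComp σ w x' = x := by
  induction k generalizing x with
  | zero => exact ⟨[], rfl, x, rfl⟩
  | succ k ih =>
    obtain ⟨i, x', rfl⟩ := h.exists_eq x
    obtain ⟨w, hw, x'', rfl⟩ := ih x'
    exact ⟨i :: w, by simp [hw], x'', rfl⟩

theorem exists_small [CompactSpace X] (h : IsSelfSimilarTree σ V) {ε : ℝ} (hε : 0 < ε) :
    ∃ k₀, ∀ k, k₀ ≤ k → ∀ w : List ι, w.length = k →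
      ∀ a b, dist (wordComp σ w a) (wordComp σ w b) < ε := by
  obtain ⟨ρ, h0, h1, hρ⟩ := h.contracting
  have hw : ∀ (w : List ι) (a b), dist (wordComp σ w a) (wordComp σ w b)
      ≤ ρ ^ w.length * dist a b := by
    intro w a b
    induction w with
    | nil => simp [wordComp]
    | cons i w ih =>
      calc _ ≤ ρ * dist (wordComp σ w a) (wordComp σ w b) := hρ i _ _
        _ ≤ ρ * (ρ ^ w.length * dist a b) := by gcongr
        _ = _ := by rw [List.length_cons]; ring
  obtain ⟨D, hD⟩ := Metric.isBounded_iff.1 (isCompact_univ (X := X)).isBounded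
  have hlim : Filter.Tendsto (fun k : ℕ => ρ ^ k * D) Filter.atTop (𝓝 0) := by
    simpa using (tendsto_pow_atTop_nhds_zero_of_lt_one h0 h1).mul_const D
  obtain ⟨k₀, hk₀⟩ := Filter.eventually_atTop.1 (hlim.eventually (gt_mem_nhds hε))
  refine ⟨k₀, fun k hk w hwk a b => (hw w a b).trans_lt (lt_of_le_of_lt ?_ (hk₀ k hk))⟩
  rw [hwk]
  have := hD (mem_univ a) (mem_univ b)
  gcongr

variable [CompactSpace X]

/-- A clopen set contains or avoids each sufficiently small piece, hence, going up level by level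
along the connected intersection graph, the whole space. -/
theorem preconnectedSpace (h : IsSelfSimilarTree σ V) : PreconnectedSpace X := by
  have key : ∀ (k : ℕ) (U : Set X), (∀ w : List ι, w.length = k → ∀ x y,
      (wordComp σ w x ∈ U ↔ wordComp σ w y ∈ U)) → ∀ x y, (x ∈ U ↔ y ∈ U) := by
    intro k
    induction k with
    | zero => exact fun U hU => hU [] rfl
    | succ k ih =>
      intro U hU
      have hi : ∀ i x y, (σ i x ∈ U ↔ σ i y ∈ U) := fun i =>
        ih (σ i ⁻¹' U) fun w hw => hU (i :: w) (by simp [hw])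
      intro x y
      have := h.connected (fun i => σ i x ∈ U) fun i j a b hab => by
        rw [hi i x a, hi j x b, hab]
      obtain ⟨i, a, rfl⟩ := h.exists_eq x
      obtain ⟨j, b, rfl⟩ := h.exists_eq y
      exact (hi i a (σ i a)).trans ((this i j).trans (hi j _ b))
  refine ⟨isPreconnected_iff_subset_of_disjoint.2 fun u v hu hv huv hd => ?_⟩
  -- `u` and `v` are complementary, so `u` is clopen.
  have hcompl : v = uᶜ := by
    ext x
    constructor
    · intro hv hu
      have : x ∈ univ ∩ (u ∩ v) := ⟨trivial, hu, hv⟩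
      rwa [hd] at this
    · exact fun hx => (huv (mem_univ x)).resolve_left hx
  obtain ⟨ε, hε, hball⟩ := lebesgue_number_lemma_of_metric (isCompact_univ (X := X))
    (c := fun b : Bool => cond b u v) (by rintro (_ | _) <;> assumption)
    (fun x hx => by
      rcases huv hx with h | h
      · exact mem_iUnion.2 ⟨true, h⟩
      · exact mem_iUnion.2 ⟨false, h⟩)
  obtain ⟨k, hk⟩ := h.exists_small hε
  have huniv := key k u fun w hw x y => by
    obtain ⟨b, hb⟩ := hball (wordComp σ w x) trivial
    have hx := hb (Metric.mem_ball_self hε)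
    have hy := hb (Metric.mem_ball.2 (hk k le_rfl w hw y x))
    cases b
    · simp only [cond_false, hcompl, mem_compl_iff] at hx hy
      simp [hx, hy]
    · simp only [cond_true] at hx hy
      simp [hx, hy]
  by_cases hne : ∃ x, x ∈ u
  · obtain ⟨x, hx⟩ := hne
    exact Or.inl fun y _ => (huniv x y).1 hx
  · right
    intro y _
    rw [hcompl]
    exact fun hy => hne ⟨y, hy⟩

/-- A map to the circle that lifts to the line on every piece of level `k` lifts globally. -/
theorem exists_lift [Finite ι] (h : IsSelfSimilarTree σ V) (k : ℕ) (f : X → AddCircle (1 : ℝ))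
    (hf : ∀ w : List ι, w.length = k → ∃ g : C(X, ℝ), ∀ x, (g x : AddCircle (1 : ℝ)) =
      f (wordComp σ w x)) : ∃ g : C(X, ℝ), ∀ x, (g x : AddCircle (1 : ℝ)) = f x := by
  induction k generalizing f with
  | zero => exact hf [] rfl
  | succ k ih =>
    have hi : ∀ i, ∃ g : C(X, ℝ), ∀ x, (g x : AddCircle (1 : ℝ)) = f (σ i x) := fun i =>
      ih (fun x => f (σ i x)) fun w hw => hf (i :: w) (by simp [hw])
    choose g hg using hi
    obtain ⟨c, hc⟩ := h.lift g fun i j x x' hx => by rw [hg, hg, hx]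
    choose I P hIP using h.exists_eq
    have hG : ∀ i x, g (I (σ i x)) (P (σ i x)) + c (I (σ i x)) = g i x + c i := fun i x =>
      hc _ _ _ _ (hIP (σ i x))
    refine ⟨⟨fun x => g (I x) (P x) + c (I x), ?_⟩, fun x => ?_⟩
    · refine continuous_of_finite_compact_cover h.continuous h.exists_eq fun i => ?_
      simp only [hG]
      fun_prop
    · have : ((c (I x) : ℝ) : AddCircle (1 : ℝ)) = 0 :=
        (AddCircle.coe_eq_zero_iff 1).2 ⟨c (I x), by simp⟩
      rw [ContinuousMap.coe_mk, AddCircle.coe_add, this, add_zero, hg, hIP]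

end IsSelfSimilarTree
end SelfSimilarTree

/-! ### Stars of points, branches, and the upper bound for the order -/

section SelfSimilarTree

variable {X ι : Type*} {σ : ι → X → X} {k : ℕ} {x y : X}

theorem mem_star : x ∈ pieceStar σ k y ↔ ∃ w ∈ wordsThrough σ k y, x ∈ range (wordComp σ w) := by
  simp [pieceStar]

theorem mem_costar : x ∈ pieceCostar σ k y ↔
    ∃ w : List ι, w.length = k ∧ y ∉ range (wordComp σ w) ∧ x ∈ range (wordComp σ w) := by
  simp [pieceCostar, and_assoc]

theorem range_subset_costar {w : List ι} (hw : w.length = k) (hy : y ∉ range (wordComp σ w)) :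
    range (wordComp σ w) ⊆ pieceCostar σ k y := fun _ hx => mem_costar.2 ⟨w, hw, hy, hx⟩

theorem finite_wordsThrough [Finite ι] (σ : ι → X → X) (k : ℕ) (y : X) :
    (wordsThrough σ k y).Finite :=
  (List.finite_length_eq ι k).subset fun _ hw => hw.1

theorem notMem_costar (σ : ι → X → X) (k : ℕ) (y : X) : y ∉ pieceCostar σ k y := fun hy => by
  obtain ⟨w, -, h1, h2⟩ := mem_costar.1 hy
  exact h1 h2

namespace IsSelfSimilarTree

variable [MetricSpace X] {V : Set X}

theorem star_union_costar (h : IsSelfSimilarTree σ V) (k : ℕ) (y : X) :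
    pieceStar σ k y ∪ pieceCostar σ k y = univ := by
  refine eq_univ_of_forall fun x => ?_
  obtain ⟨w, hw, hx⟩ := h.exists_wordComp_eq k x
  by_cases hy : y ∈ range (wordComp σ w)
  · exact Or.inl (mem_star.2 ⟨w, ⟨hw, hy⟩, hx⟩)
  · exact Or.inr (mem_costar.2 ⟨w, hw, hy, hx⟩)

theorem mem_star_self (h : IsSelfSimilarTree σ V) (k : ℕ) (y : X) : y ∈ pieceStar σ k y := by
  obtain ⟨w, hw, hx⟩ := h.exists_wordComp_eq k y
  exact mem_star.2 ⟨w, ⟨hw, hx⟩, hx⟩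

theorem costar_mono (h : IsSelfSimilarTree σ V) {k l : ℕ} (hkl : k ≤ l) (y : X) :
    pieceCostar σ k y ⊆ pieceCostar σ l y := fun x hx => by
  obtain ⟨w, hw, hy, x', rfl⟩ := mem_costar.1 hx
  obtain ⟨u, hu, x'', rfl⟩ := h.exists_wordComp_eq (l - k) x'
  refine mem_costar.2 ⟨w ++ u, by simp [hw, hu, hkl], ?_, x'', by rw [wordComp_append]; rfl⟩
  rintro ⟨z, rfl⟩
  exact hy ⟨wordComp σ u z, by rw [wordComp_append]; rfl⟩

/-- The pieces of level `k` through `y` meet the others in images of vertices only. -/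
theorem exists_vertex_of_mem_star_of_mem_costar (h : IsSelfSimilarTree σ V)
    (h1 : x ∈ pieceStar σ k y) (h2 : x ∈ pieceCostar σ k y) :
    ∃ w ∈ wordsThrough σ k y, ∃ v ∈ V, wordComp σ w v = x := by
  obtain ⟨w, hw, a, rfl⟩ := mem_star.1 h1
  obtain ⟨u, hu, hy, b, hb⟩ := mem_costar.1 h2
  refine ⟨w, hw, a, h.mem_of_wordComp_eq (hw.1.trans hu.symm) ?_ hb.symm, rfl⟩
  rintro rfl
  exact hy hw.2

variable [CompactSpace X]

theorem exists_notMem_star (h : IsSelfSimilarTree σ V) (hxy : x ≠ y) :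
    ∃ k₀, ∀ k, k₀ ≤ k → x ∉ pieceStar σ k y := by
  obtain ⟨k₀, hk₀⟩ := h.exists_small (dist_pos.2 hxy)
  refine ⟨k₀, fun k hk hx => ?_⟩
  obtain ⟨w, ⟨hw, b, rfl⟩, a, rfl⟩ := mem_star.1 hx
  exact (hk₀ k hk w hw a b).false

theorem isPreconnected_range (h : IsSelfSimilarTree σ V) (w : List ι) :
    IsPreconnected (range (wordComp σ w)) := by
  have := h.preconnectedSpace
  exact _root_.isPreconnected_range (h.continuous_wordComp w)

theorem isPreconnected_star (h : IsSelfSimilarTree σ V) (k : ℕ) (y : X) :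
    IsPreconnected (pieceStar σ k y) := by
  rw [pieceStar, biUnion_eq_iUnion]
  exact isPreconnected_iUnion ⟨y, mem_iInter.2 fun w => w.2.2⟩ fun w => h.isPreconnected_range w

theorem exists_star_subset (h : IsSelfSimilarTree σ V) {U : Set X} (hU : U ∈ 𝓝 y) :
    ∃ k, pieceStar σ k y ⊆ U := by
  obtain ⟨ε, hε, hb⟩ := Metric.mem_nhds_iff.1 hU
  obtain ⟨k, hk⟩ := h.exists_small hε
  refine ⟨k, fun x hx => hb ?_⟩
  obtain ⟨w, ⟨hw, b, rfl⟩, a, rfl⟩ := mem_star.1 hx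
  exact hk k le_rfl w hw a b

variable [Finite ι]

theorem isClosed_star (h : IsSelfSimilarTree σ V) (k : ℕ) (y : X) : IsClosed (pieceStar σ k y) :=
  (finite_wordsThrough σ k y).isClosed_biUnion fun w _ =>
    (isCompact_range (h.continuous_wordComp w)).isClosed

theorem isClosed_costar (h : IsSelfSimilarTree σ V) (k : ℕ) (y : X) :
    IsClosed (pieceCostar σ k y) :=
  ((List.finite_length_eq ι k).subset fun _ hw => hw.1).isClosed_biUnion fun w _ =>
    (isCompact_range (h.continuous_wordComp w)).isClosed

theorem star_mem_nhds (h : IsSelfSimilarTree σ V) (k : ℕ) (y : X) : pieceStar σ k y ∈ 𝓝 y := by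
  refine Filter.mem_of_superset
    ((h.isClosed_costar k y).isOpen_compl.mem_nhds (notMem_costar σ k y)) fun x hx => ?_
  have : x ∈ pieceStar σ k y ∪ pieceCostar σ k y := h.star_union_costar k y ▸ mem_univ x
  exact this.resolve_right hx

theorem locallyConnectedSpace (h : IsSelfSimilarTree σ V) : LocallyConnectedSpace X :=
  locallyConnectedSpace_of_connected_bases (fun y k => pieceStar σ k y) (fun _ _ => True)
    (fun y => ⟨fun _ => ⟨fun ht => (h.exists_star_subset ht).imp fun _ hk => ⟨trivial, hk⟩,
      fun ⟨k, _, hk⟩ => Filter.mem_of_superset (h.star_mem_nhds k y) hk⟩⟩)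
    fun y k _ => h.isPreconnected_star k y

/-- A connected union of pieces that avoid `y` is attached to the star of `y` at a single point.
If there were two such points `p ≠ q`, a function `g` equal to `1` at `p` and `0` at the finitely
many other points where the star meets the remaining pieces would give a map to the circle
(`g` modulo `1` on the star, `0` elsewhere) that winds once around the cycle through `p` and `q`
and so does not lift. -/
theorem subsingleton_inter_star (h : IsSelfSimilarTree σ V) {B : Set X} (hB : IsPreconnected B)
    (hBs : B ⊆ pieceCostar σ k y) : (B ∩ pieceStar σ k y).Subsingleton := by
  classical
  rintro p ⟨hpB, hpS⟩ q ⟨hqB, hqS⟩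
  by_contra hpq
  set F : Set X := pieceStar σ k y ∩ pieceCostar σ k y with hF
  have hFfin : F.Finite := by
    refine (((finite_wordsThrough σ k y).prod h.finite).image
      fun e => wordComp σ e.1 e.2).subset fun x hx => ?_
    obtain ⟨w, hw, v, hv, rfl⟩ := h.exists_vertex_of_mem_star_of_mem_costar hx.1 hx.2
    exact ⟨(w, v), ⟨hw, hv⟩, rfl⟩
  obtain ⟨g, hg0, hg1, -⟩ := exists_continuous_zero_one_of_isClosed
    (s := F \ {p}) (t := {p}) (hFfin.subset sdiff_subset).isClosed isClosed_singleton
    disjoint_sdiff_left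
  have hgF : ∀ x ∈ F, ((g x : ℝ) : AddCircle (1 : ℝ)) = 0 := fun x hx => by
    by_cases hxp : x = p
    · rw [hg1 hxp]
      exact AddCircle.coe_period 1
    · rw [hg0 ⟨hx, hxp⟩]
      rfl
  set f : X → AddCircle (1 : ℝ) := fun x =>
    if x ∈ pieceStar σ k y then ((g x : ℝ) : AddCircle (1 : ℝ)) else 0
    with hf
  have hfS : ∀ x ∈ pieceStar σ k y, f x = (g x : ℝ) := fun x hx => if_pos hx
  have hfN : ∀ x ∈ pieceCostar σ k y, f x = ((0 : ℝ) : AddCircle (1 : ℝ)) := fun x hx => by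
    by_cases hxS : x ∈ pieceStar σ k y
    · rw [hfS x hxS, hgF x ⟨hxS, hx⟩]; rfl
    · exact if_neg hxS
  obtain ⟨l, hl⟩ := h.exists_lift k f fun w hw => by
    by_cases hy : y ∈ range (wordComp σ w)
    · exact ⟨g.comp ⟨_, h.continuous_wordComp w⟩, fun x =>
        (hfS _ (mem_star.2 ⟨w, ⟨hw, hy⟩, x, rfl⟩)).symm⟩
    · exact ⟨0, fun x => (hfN _ (mem_costar.2 ⟨w, hw, hy, x, rfl⟩)).symm⟩
  have hlB : l p - 0 = l q - 0 := hB.sub_eq_sub_of_coe_eq (f := l) (g := fun _ => 0)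
    l.continuous.continuousOn continuousOn_const
    (fun x hx => by rw [hl, hfN x (hBs hx)]) hpB hqB
  have hlS : l p - g p = l q - g q := (h.isPreconnected_star k y).sub_eq_sub_of_coe_eq
    l.continuous.continuousOn g.continuous.continuousOn
    (fun x hx => by rw [hl, hfS x hx]) hpS hqS
  have h1 : g p = 1 := hg1 rfl
  have h0 : g q = 0 := hg0 ⟨⟨hqS, hBs hqB⟩, fun h' => hpq h'.symm⟩
  rw [h1, h0] at hlS
  linarith

/-- Points of one component of `X ∖ {y}` are joined by a connected set avoiding a whole star
of `y`. -/
theorem exists_joined_in_costar (h : IsSelfSimilarTree σ V) {C : Set X}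
    (hC : C ∈ complComponents y) {a b : X} (ha : a ∈ C) (hb : b ∈ C) :
    ∃ k, ∃ T : Set X, IsPreconnected T ∧ T ⊆ pieceCostar σ k y ∧ a ∈ T ∧ b ∈ T := by
  refine (complComponents.isPreconnected hC).induction₂
    (fun a b => ∃ k, ∃ T : Set X, IsPreconnected T ∧ T ⊆ pieceCostar σ k y ∧ a ∈ T ∧ b ∈ T)
    ?_ ?_ ?_ ha hb
  · intro x hx
    have hxy : y ≠ x := fun h' => complComponents.notMem hC (h' ▸ hx)
    obtain ⟨k, hk⟩ := h.exists_notMem_star hxy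
    refine Filter.eventually_of_mem (mem_nhdsWithin_of_mem_nhds (h.star_mem_nhds k x))
      fun z hz => ⟨k, pieceStar σ k x, h.isPreconnected_star k x, ?_, h.mem_star_self k x, hz⟩
    intro z hz
    obtain ⟨w, hw, hzw⟩ := mem_star.1 hz
    exact mem_costar.2 ⟨w, hw.1, fun hy => hk k le_rfl (mem_star.2 ⟨w, hw, hy⟩), hzw⟩
  · rintro a b c - - - ⟨k, T, hT, hTs, haT, hbT⟩ ⟨k', T', hT', hTs', hbT', hcT'⟩
    exact ⟨max k k', T ∪ T', hT.union b hbT hbT' hT',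
      union_subset (hTs.trans (h.costar_mono (le_max_left _ _) y))
        (hTs'.trans (h.costar_mono (le_max_right _ _) y)), Or.inl haT, Or.inr hcT'⟩
  · rintro a b - - ⟨k, T, hT, hTs, haT, hbT⟩
    exact ⟨k, T, hT, hTs, hbT, haT⟩

/-- All of a component `C` of `X ∖ {y}` but the part in a given star of `y` can be cut off from
`y` at a single point. -/
theorem exists_branch (h : IsSelfSimilarTree σ V) {C : Set X} (hC : C ∈ complComponents y)
    (k : ℕ) : ∃ B : Set X, IsClosed B ∧ B ⊆ C ∧ C ⊆ pieceStar σ k y ∪ B ∧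
      (frontier B).Subsingleton := by
  obtain ⟨c, hc⟩ := complComponents.nonempty hC
  have hW : {w : List ι | w.length = k ∧ range (wordComp σ w) ⊆ C}.Finite :=
    (List.finite_length_eq ι k).subset fun _ hw => hw.1
  have hj : ∀ w : List ι, ∃ l, w ∈ {w : List ι | w.length = k ∧ range (wordComp σ w) ⊆ C} →
      ∃ T : Set X, IsPreconnected T ∧ T ⊆ pieceCostar σ l y ∧ c ∈ T ∧ wordComp σ w c ∈ T := by
    intro w
    by_cases hw : w ∈ {w : List ι | w.length = k ∧ range (wordComp σ w) ⊆ C}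
    · obtain ⟨l, hl⟩ := h.exists_joined_in_costar hC hc (hw.2 (mem_range_self c))
      exact ⟨l, fun _ => hl⟩
    · exact ⟨0, fun h' => absurd h' hw⟩
  choose l hl using hj
  obtain ⟨k₁, hk₁⟩ := h.exists_notMem_star (fun h' => complComponents.notMem hC (h' ▸ hc) : c ≠ y)
  obtain ⟨L, hL⟩ := (hW.image l).bddAbove
  set K := max (max k k₁) L
  have hcK : c ∈ pieceCostar σ K y := by
    have : c ∈ pieceStar σ K y ∪ pieceCostar σ K y := h.star_union_costar K y ▸ mem_univ c
    exact this.resolve_left (hk₁ K ((le_max_right _ _).trans (le_max_left _ _)))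
  set B := connectedComponentIn (pieceCostar σ K y) c with hBdef
  have hBN : B ⊆ pieceCostar σ K y := connectedComponentIn_subset _ _
  have hcB : c ∈ B := mem_connectedComponentIn hcK
  have hBpre : IsPreconnected B := isPreconnected_connectedComponentIn
  have hBC : B ⊆ C := complComponents.subset_of_isPreconnected hC hBpre
    (fun hy => notMem_costar σ K y (hBN hy)) hcB hc
  have hsub : ∀ {T : Set X} {x : X}, IsPreconnected T → T ⊆ pieceCostar σ K y → x ∈ T → x ∈ B →
      T ⊆ B := fun {T x} hT hTN hxT hxB => by
    rw [hBdef, connectedComponentIn_eq hxB]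
    exact hT.subset_connectedComponentIn hxT hTN
  have hBcl : IsClosed B := by
    refine closure_subset_iff_isClosed.1 (hsub hBpre.closure ?_ (subset_closure hcB) hcB)
    exact closure_minimal hBN (h.isClosed_costar K y)
  refine ⟨B, hBcl, hBC, fun x hx => ?_, ?_⟩
  · by_contra! hxn
    rw [mem_union, not_or] at hxn
    have hxk : x ∈ pieceCostar σ k y := by
      have : x ∈ pieceStar σ k y ∪ pieceCostar σ k y := h.star_union_costar k y ▸ mem_univ x
      exact this.resolve_left hxn.1
    obtain ⟨w, hw, hyw, hxw⟩ := mem_costar.1 hxk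
    have hwC : range (wordComp σ w) ⊆ C := complComponents.subset_of_isPreconnected hC
      (h.isPreconnected_range w) hyw hxw hx
    obtain ⟨T, hT, hTN, hcT, hwT⟩ := hl w ⟨hw, hwC⟩
    have hTB : T ⊆ B := hsub hT (hTN.trans (h.costar_mono
      ((hL ⟨w, ⟨hw, hwC⟩, rfl⟩).trans (le_max_right _ _)) y)) hcT hcB
    refine hxn.2 (hsub (h.isPreconnected_range w) ?_ (mem_range_self c) (hTB hwT) hxw)
    exact (range_subset_costar hw hyw).trans
      (h.costar_mono ((le_max_left _ _).trans (le_max_left _ _)) y)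
  -- The other pieces that avoid `y` are at positive distance from `B`.
  · set R : Set X := ⋃ w ∈ {w : List ι | w.length = K ∧ Disjoint (range (wordComp σ w)) B},
      range (wordComp σ w) with hR
    have hRcl : IsClosed R := ((List.finite_length_eq ι K).subset fun _ hw => hw.1).isClosed_biUnion
      fun w _ => (isCompact_range (h.continuous_wordComp w)).isClosed
    have hRB : Disjoint R B := disjoint_iUnion₂_left.2 fun w hw => hw.2
    have hcover : Bᶜ ⊆ pieceStar σ K y ∪ R := fun x hx => by
      obtain ⟨w, hw, hxw⟩ := h.exists_wordComp_eq K x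
      by_cases hy : y ∈ range (wordComp σ w)
      · exact Or.inl (mem_star.2 ⟨w, ⟨hw, hy⟩, hxw⟩)
      · refine Or.inr (mem_iUnion₂.2 ⟨w, ⟨hw, disjoint_left.2 fun z hz hzB => hx ?_⟩, hxw⟩)
        exact hsub (h.isPreconnected_range w) (range_subset_costar hw hy) hz hzB hxw
    refine (h.subsingleton_inter_star hBpre hBN).anti fun x hx => ?_
    rw [frontier_eq_closure_inter_closure, hBcl.closure_eq] at hx
    refine ⟨hx.1, ?_⟩
    exact (closure_minimal hcover ((h.isClosed_star K y).union hRcl) hx.2).resolve_right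
      fun hxR => disjoint_left.1 hRB hxR hx.1

theorem mengerOrder_le_encard (h : IsSelfSimilarTree σ V) (hfin : (complComponents y).Finite) :
    mengerOrder y ≤ (complComponents y).encard := by
  refine sInf_le fun U hU => ?_
  obtain ⟨k, hk⟩ := h.exists_star_subset hU
  have := fun C : complComponents y => h.exists_branch C.2 k
  choose B hBcl hBC hCB hBfr using this
  have : Finite (complComponents y) := hfin
  have hUcl : IsClosed (⋃ C, B C) := isClosed_iUnion_of_finite hBcl
  refine ⟨(⋃ C, B C)ᶜ, fun x hx => hk ?_, hUcl.isOpen_compl, ?_, ?_⟩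
  · by_cases hxy : x = y
    · exact hxy ▸ h.mem_star_self k x
    · obtain ⟨C, hC, hxC⟩ := complComponents.exists_mem hxy
      exact (hCB ⟨C, hC⟩ hxC).resolve_right fun hxB => hx (mem_iUnion.2 ⟨_, hxB⟩)
  · intro hy
    obtain ⟨C, hyC⟩ := mem_iUnion.1 hy
    exact complComponents.notMem C.2 (hBC C hyC)
  · have hfr : ∀ x : frontier (⋃ C, B C)ᶜ, ∃ C, (x : X) ∈ frontier (B C) := by
      rintro ⟨x, hx⟩
      rw [frontier_compl, hUcl.frontier_eq] at hx
      obtain ⟨C, hxC⟩ := mem_iUnion.1 hx.1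
      refine ⟨C, ?_⟩
      rw [(hBcl C).frontier_eq]
      exact ⟨hxC, fun hi => hx.2 (interior_mono (subset_iUnion B C) hi)⟩
    choose f hf using hfr
    refine ENat.card_le_card_of_injective (f := f) fun x x' hxx => Subtype.ext ?_
    exact hBfr (f x) (hf x) (hxx ▸ hf x')

end IsSelfSimilarTree
end SelfSimilarTree

/-! ### The order of a point as a sum over the pieces through it -/

section SelfSimilarTree

variable {X ι : Type*} {σ : ι → X → X} {y : X}

namespace IsSelfSimilarTree

variable [MetricSpace X] {V : Set X} [CompactSpace X] [Finite ι]

/-- A component of `X ∖ {y}` leaves every sufficiently small star of `y`, and it can only do so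
through the image of a vertex. -/
theorem exists_vertex_mem (h : IsSelfSimilarTree σ V) {C : Set X} (hC : C ∈ complComponents y) :
    ∃ k₀, ∀ k, k₀ ≤ k → ∃ w ∈ wordsThrough σ k y, ∃ v ∈ V, wordComp σ w v ∈ C := by
  have := h.preconnectedSpace
  have := h.locallyConnectedSpace
  obtain ⟨c, hc⟩ := complComponents.nonempty hC
  obtain ⟨k₀, hk₀⟩ := h.exists_notMem_star (fun h' => complComponents.notMem hC (h' ▸ hc) : c ≠ y)
  refine ⟨k₀, fun k hk => ?_⟩
  obtain ⟨z, hzS, hzC⟩ := mem_closure_iff_nhds.1 (complComponents.mem_closure hC) _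
    (h.star_mem_nhds k y)
  have hcover := h.star_union_costar k y
  obtain ⟨x, hxC, hxS, hxN⟩ := isPreconnected_closed_iff.1 (complComponents.isPreconnected hC)
    _ _ (h.isClosed_star k y) (h.isClosed_costar k y) (hcover ▸ subset_univ C) ⟨z, hzC, hzS⟩
    ⟨c, hc, ((hcover ▸ mem_univ c : c ∈ pieceStar σ k y ∪ pieceCostar σ k y)).resolve_left
      (hk₀ k hk)⟩
  obtain ⟨w, hw, v, hv, rfl⟩ := h.exists_vertex_of_mem_star_of_mem_costar hxS hxN
  exact ⟨w, hw, v, hv, hxC⟩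

variable {N : ℕ}

/-- Several components of `X ∖ {y}` are told apart by images of vertices under words of one large
level through `y`; a bound for the number of such words bounds the number of components. -/
theorem finite_complComponents (h : IsSelfSimilarTree σ V)
    (hN : ∀ k, (wordsThrough σ k y).ncard ≤ N) : (complComponents y).Finite := by
  by_contra hinf
  obtain ⟨F, hF, hFcard⟩ := (show (complComponents y).Infinite from hinf).exists_subset_card_eq
    (N * V.ncard + 1)
  have hk := fun C : F => h.exists_vertex_mem (hF C.2)
  choose k hk using hk
  obtain ⟨K, hK⟩ := (finite_range k).bddAbove
  choose w hw v hv hC using fun C : F => hk C K (hK (mem_range_self C))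
  have hinj : Function.Injective
      fun C : F => (⟨(w C, v C), hw C, hv C⟩ : wordsThrough σ K y ×ˢ V) := fun C D hCD => by
    have h1 := congrArg Subtype.val hCD
    simp only [Prod.mk.injEq] at h1
    refine Subtype.ext (complComponents.eq_of_mem (hF C.2) (hF D.2) (hC C) ?_)
    rw [h1.1, h1.2]
    exact hC D
  have : Finite ↥(wordsThrough σ K y ×ˢ V) := (finite_wordsThrough σ K y).prod h.finite
  have hle := Nat.card_le_card_of_injective _ hinj
  rw [Nat.card_coe_set_eq, ncard_prod] at hle
  have := Nat.mul_le_mul_right V.ncard (hN K)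
  simp only [Nat.card_eq_fintype_card, Fintype.card_coe, hFcard] at hle
  omega

theorem mengerOrder_eq (h : IsSelfSimilarTree σ V) (hN : ∀ k, (wordsThrough σ k y).ncard ≤ N) :
    mengerOrder y = (complComponents y).encard := by
  have := h.preconnectedSpace
  have := h.locallyConnectedSpace
  have hfin := h.finite_complComponents hN
  have : Finite (complComponents y) := hfin
  refine le_antisymm (h.mengerOrder_le_encard hfin) ?_
  exact card_le_mengerOrder (C := fun C : complComponents y => (C : Set X))
    (fun C => complComponents.isPreconnected C.2) (fun C => complComponents.notMem C.2)
    (fun C => complComponents.mem_closure C.2)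
    fun C D x hC hD => Subtype.ext (complComponents.eq_of_mem C.2 D.2 hC hD)

/-- Let `v i` be the words of a large length `k` whose pieces contain `y`, and let `z i` be the
point of `X` that corresponds to `y` in the `i`-th piece. The components of the sets `X ∖ {z i}`,
carried into the pieces, correspond bijectively to the components of `X ∖ {y}`: they are disjoint
and accumulate at `y`, so there are at most `mengerOrder y` of them, and each component of
`X ∖ {y}` contains one of them together with the image of a vertex. -/
theorem exists_forall_mengerOrder_eq_sum (h : IsSelfSimilarTree σ V)
    (hN : ∀ k x, (wordsThrough σ k x).ncard ≤ N) (y : X) :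
    ∃ k₀, ∀ k, k₀ ≤ k → ∀ (s : ℕ) (v : Fin s → List ι) (z : Fin s → X), Function.Injective v →
      range v = wordsThrough σ k y → (∀ i, wordComp σ (v i) (z i) = y) →
      (∀ i, ∀ D ∈ complComponents (z i), (D ∩ V).Nonempty) ∧
      mengerOrder y = ∑ i, mengerOrder (z i) := by
  have := h.preconnectedSpace
  have := h.locallyConnectedSpace
  have hfin : ∀ x, Finite (complComponents x) := fun x =>
    h.finite_complComponents fun k => hN k x
  choose k₀ hk₀ using fun C : complComponents y => h.exists_vertex_mem C.2
  obtain ⟨K, hK⟩ := (finite_range k₀).bddAbove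
  refine ⟨K, fun k hk s v z hv hrange hz => ?_⟩
  have hvk : ∀ i, v i ∈ wordsThrough σ k y := fun i => hrange ▸ mem_range_self i
  set T : (Σ i, complComponents (z i)) → Set X := fun e => wordComp σ (v e.1) '' e.2 with hT
  have hTpre : ∀ e, IsPreconnected (T e) := fun e =>
    (complComponents.isPreconnected e.2.2).image _ (h.continuous_wordComp _).continuousOn
  have hTy : ∀ e, y ∉ T e := by
    rintro e ⟨a, ha, hay⟩
    rw [← hz e.1] at hay
    exact complComponents.notMem e.2.2 (h.injective_wordComp _ hay ▸ ha)
  have hTcl : ∀ e, y ∈ closure (T e) := fun e => by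
    rw [← hz e.1]
    exact image_closure_subset_closure_image (h.continuous_wordComp _)
      (mem_image_of_mem _ (complComponents.mem_closure e.2.2))
  have hTdisj : ∀ e e' x, x ∈ T e → x ∈ T e' → e = e' := by
    rintro ⟨i, D, hD⟩ ⟨j, D', hD'⟩ x ⟨a, ha, rfl⟩ ⟨b, hb, hab⟩
    by_cases hij : i = j
    · subst hij
      have hab' : b = a := h.injective_wordComp _ hab
      have : D = D' := complComponents.eq_of_mem hD hD' ha (hab' ▸ hb)
      subst this
      rfl
    · have haz : a = z i := h.eq_of_wordComp_eq ((hvk i).1.trans (hvk j).1.symm)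
        (fun h' => hij (hv h')) hab.symm ((hz i).trans (hz j).symm)
      exact absurd (haz ▸ ha) (complComponents.notMem hD)
  have hΦ : ∀ e, ∃ C : complComponents y, T e ⊆ C := fun e => by
    obtain ⟨C, hC, hTC⟩ := complComponents.exists_superset (hTpre e)
      ((complComponents.nonempty e.2.2).image _) (hTy e)
    exact ⟨⟨C, hC⟩, hTC⟩
  choose Φ hΦ using hΦ
  have hΦs : ∀ C : complComponents y, ∃ e, Φ e = C ∧ ((e.2 : Set X) ∩ V).Nonempty := fun C => by
    obtain ⟨w, hw, a, ha, hwa⟩ := hk₀ C k ((hK (mem_range_self C)).trans hk)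
    obtain ⟨i, rfl⟩ : w ∈ range v := hrange ▸ hw
    have hai : a ≠ z i := by
      rintro rfl
      rw [hz i] at hwa
      exact complComponents.notMem C.2 hwa
    obtain ⟨D, hD, haD⟩ := complComponents.exists_mem hai
    refine ⟨⟨i, D, hD⟩, Subtype.ext ?_, a, haD, ha⟩
    exact complComponents.eq_of_mem (Φ _).2 C.2 (hΦ ⟨i, D, hD⟩ (mem_image_of_mem _ haD)) hwa
  have hsurj : Function.Surjective Φ := fun C => (hΦs C).imp fun _ he => he.1
  have hle : ENat.card (Σ i, complComponents (z i)) ≤ mengerOrder y :=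
    card_le_mengerOrder hTpre hTy hTcl hTdisj
  have hcard : Nat.card (Σ i, complComponents (z i)) ≤ Nat.card (complComponents y) := by
    rw [h.mengerOrder_eq fun k => hN k y, ENat.card_eq_coe_natCard, ← ENat.card_coe_set_eq,
      ENat.card_eq_coe_natCard] at hle
    exact_mod_cast hle
  have hbij := hsurj.bijective_of_nat_card_le hcard
  refine ⟨fun i D hD => ?_, ?_⟩
  · obtain ⟨e, he, hV⟩ := hΦs (Φ ⟨i, D, hD⟩)
    have := hbij.1 he
    subst this
    exact hV
  · rw [h.mengerOrder_eq fun k => hN k y, ← ENat.card_coe_set_eq, ENat.card_eq_coe_natCard,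
      ← Nat.card_eq_of_bijective _ hbij, Nat.card_sigma]
    push_cast
    refine Finset.sum_congr rfl fun i _ => ?_
    rw [h.mengerOrder_eq fun k => hN k (z i), ← ENat.card_coe_set_eq, ENat.card_eq_coe_natCard]

end IsSelfSimilarTree
end SelfSimilarTree

/-! ### Self-similar families of paths -/

/-- A bounded set each point of which is the image of another of its points under a contraction
that preserves the closed set `Y` is contained in `Y`. -/
theorem subset_of_forall_exists_contraction {E : Type*} [MetricSpace E] {Y Z : Set E}
    (hZ : Bornology.IsBounded Z) (hY : IsClosed Y) (hne : Y.Nonempty) {ρ : ℝ} (h0 : 0 ≤ ρ)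
    (h1 : ρ < 1) (h : ∀ z ∈ Z, ∃ g : E → E, (∀ a b, dist (g a) (g b) ≤ ρ * dist a b) ∧
      MapsTo g Y Y ∧ ∃ z' ∈ Z, g z' = z) : Z ⊆ Y := by
  obtain ⟨y₀, hy₀⟩ := hne
  obtain ⟨D, hD⟩ := hZ.subset_closedBall y₀
  have key : ∀ k : ℕ, ∀ z ∈ Z, ∃ y ∈ Y, dist z y ≤ ρ ^ k * D := by
    intro k
    induction k with
    | zero => exact fun z hz => ⟨y₀, hy₀, by simpa using hD hz⟩
    | succ k ih =>
      intro z hz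
      obtain ⟨g, hg, hgY, z', hz', rfl⟩ := h z hz
      obtain ⟨y, hy, hyz⟩ := ih z' hz'
      refine ⟨g y, hgY hy, (hg _ _).trans ?_⟩
      calc ρ * dist z' y ≤ ρ * (ρ ^ k * D) := by gcongr
        _ = ρ ^ (k + 1) * D := by ring
  intro z hz
  rw [← hY.closure_eq, Metric.mem_closure_iff]
  intro ε hε
  have hlim : Filter.Tendsto (fun k : ℕ => ρ ^ k * D) Filter.atTop (𝓝 0) := by
    simpa using (tendsto_pow_atTop_nhds_zero_of_lt_one h0 h1).mul_const D
  obtain ⟨k, hk⟩ := (hlim.eventually (gt_mem_nhds hε)).exists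
  obtain ⟨y, hy, hyz⟩ := key k z hz
  exact ⟨y, hy, hyz.trans_lt hk⟩

section SelfSimilarPaths

open unitInterval

variable {E J : Type*} [NormedAddCommGroup E]

/-- Data for a self-similar family of paths: the path number `p`, from `src p` to `tgt p`, is to
be composed of the images under contractions `f p t` of the paths number `sub p t`, for
`0 ≤ t ≤ R p`, each of them starting where the previous one ends. -/
structure IsPathSystem (src tgt : J → E) (R : J → ℕ) (f : J → ℕ → E → E) (sub : J → ℕ → J) :
    Prop where
  contracting : ∃ ρ : ℝ, 0 ≤ ρ ∧ ρ < 1 ∧ ∀ p t x y, dist (f p t x) (f p t y) ≤ ρ * dist x y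
  first : ∀ p, f p 0 (src (sub p 0)) = src p
  next : ∀ p t, t < R p → f p t (tgt (sub p t)) = f p (t + 1) (src (sub p (t + 1)))
  last : ∀ p, f p (R p) (tgt (sub p (R p))) = tgt p

/-- A family of paths that are composed as an `IsPathSystem` prescribes. -/
structure IsSelfSimilarPaths (src tgt : J → E) (R : J → ℕ) (f : J → ℕ → E → E) (sub : J → ℕ → J)
    (γ : J → C(I, E)) : Prop where
  zero : ∀ p, γ p 0 = src p
  one : ∀ p, γ p 1 = tgt p
  apply : ∀ p t (s : I), t ≤ R p → (t : ℝ) ≤ (R p + 1) * s → ((R p + 1) * s : ℝ) ≤ t + 1 →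
    γ p s = f p t (γ (sub p t) (projIcc 0 1 zero_le_one ((R p + 1) * s - t)))

/-- The index `t` of the part of length `1 / (R + 1)` of the unit interval that contains `s`. -/
theorem exists_index (R : ℕ) (s : I) : ∃ t ≤ R, (t : ℝ) ≤ (R + 1) * s ∧
    ((R + 1) * s : ℝ) ≤ t + 1 ∧ (t < R → ((R + 1) * s : ℝ) < t + 1) := by
  have h0 : (0 : ℝ) ≤ (R + 1) * s := mul_nonneg (by positivity) s.2.1
  by_cases h : ((R + 1) * s : ℝ) < R
  · refine ⟨⌊((R + 1) * s : ℝ)⌋₊, ?_, Nat.floor_le h0, (Nat.lt_floor_add_one _).le,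
      fun _ => Nat.lt_floor_add_one _⟩
    exact (Nat.floor_lt h0).2 h |>.le
  · refine ⟨R, le_rfl, not_lt.1 h, ?_, fun h' => absurd h' (lt_irrefl _)⟩
    have := s.2.2
    have hR : (0 : ℝ) ≤ R + 1 := by positivity
    nlinarith

variable {src tgt : J → E} {R : J → ℕ} {f : J → ℕ → E → E} {sub : J → ℕ → J}

namespace IsPathSystem

/-- The composite paths, written as a sum in which each part contributes only while it is
traversed, so that continuity needs no gluing. -/
noncomputable def concat (h : IsPathSystem src tgt R f sub) (γ : J → C(I, E)) (p : J) :
    C(I, E) where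
  toFun s := src p + ∑ t ∈ Finset.range (R p + 1),
    (f p t (γ (sub p t) (projIcc 0 1 zero_le_one ((R p + 1) * s - t))) - f p t (γ (sub p t) 0))
  continuous_toFun := by
    obtain ⟨ρ, h0, -, hρ⟩ := h.contracting
    have hf : ∀ t, Continuous (f p t) := fun t =>
      (LipschitzWith.of_dist_le_mul (K := ⟨ρ, h0⟩) (hρ p t)).continuous
    have hproj : Continuous (projIcc (0 : ℝ) 1 zero_le_one) := continuous_projIcc
    refine continuous_const.add (continuous_finsetSum _ fun t _ => Continuous.sub ?_
      continuous_const)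
    exact (hf t).comp ((γ _).continuous.comp (hproj.comp (by fun_prop)))

theorem concat_apply (h : IsPathSystem src tgt R f sub) {γ : J → C(I, E)}
    (h0 : ∀ q, γ q 0 = src q) (h1 : ∀ q, γ q 1 = tgt q) {p : J} {t : ℕ} {s : I} (ht : t ≤ R p)
    (hts : (t : ℝ) ≤ (R p + 1) * s) (hst : ((R p + 1) * s : ℝ) ≤ t + 1) :
    h.concat γ p s = f p t (γ (sub p t) (projIcc 0 1 zero_le_one ((R p + 1) * s - t))) := by
  set F : ℕ → E := fun t => f p t (γ (sub p t) (projIcc 0 1 zero_le_one ((R p + 1) * s - t))) -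
    f p t (γ (sub p t) 0) with hF
  have hpart : ∀ u, u ≤ t → src p + ∑ v ∈ Finset.range u, F v = f p u (src (sub p u)) := by
    intro u
    induction u with
    | zero => intro _; simp [h.first]
    | succ u ih =>
      intro hu
      have h1u : projIcc (0 : ℝ) 1 zero_le_one ((R p + 1) * s - u) = 1 := by
        have : (u : ℝ) + 1 ≤ t := by exact_mod_cast hu
        exact projIcc_of_right_le _ (by linarith)
      rw [Finset.sum_range_succ, ← add_assoc, ih (by omega), hF]
      simp only [h1u, h1, h0]
      rw [h.next p u (by omega)]
      abel
  have hrest : ∀ T, t + 1 ≤ T → src p + ∑ v ∈ Finset.range T, F v =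
      f p t (γ (sub p t) (projIcc 0 1 zero_le_one ((R p + 1) * s - t))) := by
    intro T hT
    induction T, hT using Nat.le_induction with
    | base =>
      rw [Finset.sum_range_succ, ← add_assoc, hpart t le_rfl, hF]
      simp only [h0]
      abel
    | succ T hT ih =>
      have h0T : projIcc (0 : ℝ) 1 zero_le_one ((R p + 1) * s - T) = 0 := by
        have : (t : ℝ) + 1 ≤ T := by exact_mod_cast hT
        exact projIcc_of_le_left _ (by linarith)
      rw [Finset.sum_range_succ, ← add_assoc, ih, hF]
      simp [h0T]
  exact hrest (R p + 1) (by omega)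

theorem concat_zero (h : IsPathSystem src tgt R f sub) {γ : J → C(I, E)}
    (h0 : ∀ q, γ q 0 = src q) (h1 : ∀ q, γ q 1 = tgt q) (p : J) : h.concat γ p 0 = src p := by
  rw [h.concat_apply h0 h1 (Nat.zero_le _) (by simp) (by simp)]
  simp [h0, h.first]

theorem concat_one (h : IsPathSystem src tgt R f sub) {γ : J → C(I, E)}
    (h0 : ∀ q, γ q 0 = src q) (h1 : ∀ q, γ q 1 = tgt q) (p : J) : h.concat γ p 1 = tgt p := by
  rw [h.concat_apply h0 h1 le_rfl (by simp) (by simp)]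
  simp [h1, h.last]

/-- Composing the paths of a family anew is a contraction of the complete space of families with
the given end points, so it has a fixed point. -/
theorem exists_isSelfSimilarPaths [NormedSpace ℝ E] [CompleteSpace E] [Finite J]
    (h : IsPathSystem src tgt R f sub) : ∃ γ, IsSelfSimilarPaths src tgt R f sub γ := by
  have := Fintype.ofFinite J
  obtain ⟨ρ, hρ0, hρ1, hρ⟩ := h.contracting
  set F : Set (J → C(I, E)) := {γ | ∀ q, γ q 0 = src q ∧ γ q 1 = tgt q} with hF
  have hFcl : IsClosed F := by
    have : F = ⋂ q, {γ | γ q 0 = src q} ∩ {γ | γ q 1 = tgt q} := by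
      ext γ
      simp [hF]
    rw [this]
    refine isClosed_iInter fun q => IsClosed.inter ?_ ?_ <;>
    exact isClosed_eq ((continuous_eval_const _).comp (continuous_apply q))
      continuous_const
  have := hFcl.completeSpace_coe
  have : Nonempty F := by
    refine ⟨fun q => ⟨fun s => AffineMap.lineMap (src q) (tgt q) (s : ℝ), ?_⟩, fun q => ?_⟩
    · exact AffineMap.lineMap_continuous.comp continuous_subtype_val
    · simp
  let T : F → F := fun γ => ⟨h.concat γ.1, fun q =>
    ⟨h.concat_zero (fun q => (γ.2 q).1) (fun q => (γ.2 q).2) q,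
      h.concat_one (fun q => (γ.2 q).1) (fun q => (γ.2 q).2) q⟩⟩
  have hT : ContractingWith ⟨ρ, hρ0⟩ T := by
    refine ⟨by exact_mod_cast hρ1, LipschitzWith.of_dist_le_mul fun γ γ' => ?_⟩
    have hnn : 0 ≤ ρ * dist γ γ' := by positivity
    refine (dist_pi_le_iff hnn).2 fun p => (ContinuousMap.dist_le hnn).2 fun s => ?_
    obtain ⟨t, ht, hts, hst, -⟩ := exists_index (R p) s
    change dist (h.concat γ.1 p s) (h.concat γ'.1 p s) ≤ _
    rw [h.concat_apply (fun q => (γ.2 q).1) (fun q => (γ.2 q).2) ht hts hst,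
      h.concat_apply (fun q => (γ'.2 q).1) (fun q => (γ'.2 q).2) ht hts hst]
    refine (hρ _ _ _ _).trans (mul_le_mul_of_nonneg_left ?_ hρ0)
    exact (ContinuousMap.dist_apply_le_dist _).trans (dist_le_pi_dist γ.1 γ'.1 _)
  obtain ⟨γ, hγ, -⟩ := hT.exists_fixedPoint (Classical.arbitrary F) (edist_ne_top _ _)
  have hγ' : ∀ p, h.concat γ.1 p = γ.1 p := fun p => congrFun (congrArg Subtype.val hγ) p
  refine ⟨γ.1, fun p => (γ.2 p).1, fun p => (γ.2 p).2, fun p t s ht hts hst => ?_⟩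
  conv_lhs => rw [← hγ' p]
  exact h.concat_apply (fun q => (γ.2 q).1) (fun q => (γ.2 q).2) ht hts hst

end IsPathSystem

namespace IsSelfSimilarPaths

variable {γ : J → C(I, E)} {K : Set E}

theorem mem [Finite J] (hγ : IsSelfSimilarPaths src tgt R f sub γ)
    (hf : ∃ ρ : ℝ, 0 ≤ ρ ∧ ρ < 1 ∧ ∀ p t x y, dist (f p t x) (f p t y) ≤ ρ * dist x y)
    (hK : IsClosed K) (hne : K.Nonempty) (hmaps : ∀ p t, t ≤ R p → MapsTo (f p t) K K) (p : J)
    (s : I) : γ p s ∈ K := by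
  obtain ⟨ρ, h0, h1, hρ⟩ := hf
  have hsub : (⋃ q, range (γ q)) ⊆ K := by
    refine subset_of_forall_exists_contraction
      (isCompact_iUnion fun q => isCompact_range (γ q).continuous).isBounded hK hne h0 h1 ?_
    rintro z hz
    obtain ⟨q, s, rfl⟩ := mem_iUnion.1 hz
    obtain ⟨t, ht, hts, hst, -⟩ := exists_index (R q) s
    exact ⟨f q t, hρ q t, hmaps q t ht, _, mem_iUnion.2 ⟨sub q t, mem_range_self _⟩,
      (hγ.apply q t s ht hts hst).symm⟩
  exact hsub (mem_iUnion.2 ⟨p, mem_range_self s⟩)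

/-- If a path visits its end point early, so does its last part, with the lead multiplied by the
number of parts; iterating this the lead would exceed `1`. -/
theorem eq_one_of_eq_tgt (hγ : IsSelfSimilarPaths src tgt R f sub γ) (hK : ∀ p s, γ p s ∈ K)
    (hR : ∀ p, 1 ≤ R p) (hlast : ∀ p, f p (R p) (tgt (sub p (R p))) = tgt p)
    (hinj : ∀ p t, t ≤ R p → Function.Injective (f p t))
    (hend : ∀ p t, t < R p → tgt p ∉ f p t '' K) {p : J} {s : I} (hs : γ p s = tgt p) : s = 1 := by
  have key : ∀ N : ℕ, ∀ p (s : I), (1 / 2 : ℝ) ^ N < 1 - s → γ p s ≠ tgt p := by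
    intro N
    induction N with
    | zero => intro p s hs; have := s.2.1; norm_num at hs; linarith
    | succ N ih =>
      intro p s hs hγs
      obtain ⟨t, ht, hts, hst, -⟩ := exists_index (R p) s
      rw [hγ.apply p t s ht hts hst] at hγs
      rcases ht.lt_or_eq with ht | rfl
      · exact hend p t ht (hγs ▸ mem_image_of_mem _ (hK _ _))
      · rw [← hlast p] at hγs
        refine ih _ _ ?_ (hinj _ _ le_rfl hγs)
        have hmem : ((R p + 1) * s - R p : ℝ) ∈ Icc (0 : ℝ) 1 := ⟨by linarith, by linarith⟩
        rw [projIcc_of_mem _ hmem]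
        have hR' : (1 : ℝ) ≤ R p := by exact_mod_cast hR p
        have := s.2.2
        rw [pow_succ] at hs
        change (1 / 2 : ℝ) ^ N < 1 - ((R p + 1) * s - R p)
        nlinarith
  by_contra hne
  have hlt : (0 : ℝ) < 1 - s := sub_pos.2 (lt_of_le_of_ne s.2.2 fun h => hne (Subtype.ext h))
  obtain ⟨N, hN⟩ := exists_pow_lt_of_lt_one hlt (by norm_num : (1 / 2 : ℝ) < 1)
  exact key N p s hN hs

/-- The paths are injective if consecutive parts meet only where they are joined and other parts
are disjoint: a coincidence within one part is a coincidence in another path at a distance that is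
multiplied by the number of parts. -/
theorem injective (hγ : IsSelfSimilarPaths src tgt R f sub γ) (hK : ∀ p s, γ p s ∈ K)
    (hR : ∀ p, 1 ≤ R p) (hlast : ∀ p, f p (R p) (tgt (sub p (R p))) = tgt p)
    (hinj : ∀ p t, t ≤ R p → Function.Injective (f p t))
    (hend : ∀ p t, t < R p → tgt p ∉ f p t '' K)
    (hdisj : ∀ p t u, t + 1 < u → u ≤ R p → Disjoint (f p t '' K) (f p u '' K))
    (hnext : ∀ p t, t < R p → ∀ x ∈ K, ∀ x' ∈ K, f p t x = f p (t + 1) x' → x = tgt (sub p t))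
    (p : J) : Function.Injective (γ p) := by
  have key : ∀ N : ℕ, ∀ p (s s' : I), (1 / 2 : ℝ) ^ N < s' - s → γ p s ≠ γ p s' := by
    intro N
    induction N with
    | zero =>
      intro p s s' hs
      have := s.2.1
      have := s'.2.2
      norm_num at hs
      linarith
    | succ N ih =>
      intro p s s' hs hγs
      have hpos : (0 : ℝ) < (1 / 2) ^ (N + 1) := by positivity
      have hR' : (1 : ℝ) ≤ R p := by exact_mod_cast hR p
      obtain ⟨t, ht, hts, hst, hst'⟩ := exists_index (R p) s
      obtain ⟨u, hu, hus, hsu, hsu'⟩ := exists_index (R p) s'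
      have hlt : ((R p + 1) * s : ℝ) < (R p + 1) * s' := by nlinarith
      rw [hγ.apply p t s ht hts hst, hγ.apply p u s' hu hus hsu] at hγs
      have hmem : ((R p + 1) * s - t : ℝ) ∈ Icc (0 : ℝ) 1 := ⟨by linarith, by linarith⟩
      have hmem' : ((R p + 1) * s' - u : ℝ) ∈ Icc (0 : ℝ) 1 := ⟨by linarith, by linarith⟩
      have htu : t ≤ u := by
        by_contra! hut
        have h1 := hsu' (by omega)
        have : (u : ℝ) + 1 ≤ t := by exact_mod_cast hut
        linarith
      rcases htu.eq_or_lt with rfl | htu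
      · refine ih _ _ _ ?_ (hinj _ _ ht hγs)
        rw [projIcc_of_mem _ hmem, projIcc_of_mem _ hmem']
        change (1 / 2 : ℝ) ^ N < (R p + 1) * s' - t - ((R p + 1) * s - t)
        rw [pow_succ] at hs
        nlinarith
      · rcases (show t + 1 ≤ u from htu).eq_or_lt with rfl | htu'
        · have h1 := hγ.eq_one_of_eq_tgt hK hR hlast hinj hend
            (hnext p t (by omega) _ (hK _ _) _ (hK _ _) hγs)
          rw [projIcc_of_mem _ hmem] at h1
          have h1' : ((R p + 1) * s - t : ℝ) = 1 := congrArg Subtype.val h1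
          have := hst' (by omega)
          linarith
        · exact disjoint_left.1 (hdisj p t u htu' hu) (mem_image_of_mem _ (hK _ _))
            ⟨_, hK _ _, hγs.symm⟩
  have key' : ∀ s s' : I, s < s' → γ p s ≠ γ p s' := fun s s' hss => by
    obtain ⟨N, hN⟩ := exists_pow_lt_of_lt_one (sub_pos.2 (show (s : ℝ) < s' from hss))
      (by norm_num : (1 / 2 : ℝ) < 1)
    exact key N p s s' hN
  intro s s' hss
  by_contra hne
  rcases lt_or_gt_of_ne hne with hlt | hlt
  · exact key' _ _ hlt hss
  · exact key' _ _ hlt hss.symm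

end IsSelfSimilarPaths

end SelfSimilarPaths

/-! ### Chains of pieces and arcs between vertices -/

section SelfSimilarTree

variable {X ι : Type*} {σ : ι → X → X} {a b : X} {k R : ℕ} {w : ℕ → List ι}

/-- The pieces of the words `w 0, …, w R` of length `k` form a chain from `a` to `b`. -/
structure IsWordChain (σ : ι → X → X) (k : ℕ) (a b : X) (R : ℕ) (w : ℕ → List ι) : Prop where
  length : ∀ t ≤ R, (w t).length = k
  first : a ∈ range (wordComp σ (w 0))
  last : b ∈ range (wordComp σ (w R))
  next : ∀ t < R, (range (wordComp σ (w t)) ∩ range (wordComp σ (w (t + 1)))).Nonempty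

namespace IsWordChain

theorem take (h : IsWordChain σ k a b R w) {t : ℕ} (ht : t ≤ R)
    (hb : b ∈ range (wordComp σ (w t))) : IsWordChain σ k a b t w :=
  ⟨fun u hu => h.length u (hu.trans ht), h.first, hb, fun u hu => h.next u (hu.trans_le ht)⟩

theorem drop (h : IsWordChain σ k a b R w) {t : ℕ} (ht : t ≤ R)
    (ha : a ∈ range (wordComp σ (w t))) : IsWordChain σ k a b (R - t) fun u => w (u + t) := by
  refine ⟨fun u hu => h.length _ (by omega), by simpa using ha, ?_, fun u hu => ?_⟩
  · simp only [Nat.sub_add_cancel ht]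
    exact h.last
  · have := h.next (u + t) (by omega)
    rwa [show u + t + 1 = u + 1 + t by omega] at this

/-- A chain can be shortened by going directly from one piece to another one that it meets. -/
theorem shortcut (h : IsWordChain σ k a b R w) {t u : ℕ} (htu : t + 1 < u) (hu : u ≤ R)
    (hm : (range (wordComp σ (w t)) ∩ range (wordComp σ (w u))).Nonempty) :
    IsWordChain σ k a b (R - (u - t - 1))
      fun v => if v ≤ t then w v else w (v + (u - t - 1)) := by
  refine ⟨fun v hv => ?_, by simpa using h.first, ?_, fun v hv => ?_⟩
  · by_cases hvt : v ≤ t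
    · simp only [hvt, if_true]
      exact h.length _ (by omega)
    · simp only [hvt, if_false]
      exact h.length _ (by omega)
  · rw [if_neg (by omega), Nat.sub_add_cancel (by omega)]
    exact h.last
  · rcases lt_trichotomy v t with hvt | rfl | hvt
    · rw [if_pos hvt.le, if_pos (by omega)]
      exact h.next v (by omega)
    · rw [if_pos le_rfl, if_neg (by omega), show v + 1 + (u - v - 1) = u by omega]
      exact hm
    · rw [if_neg (by omega), if_neg (by omega),
        show v + 1 + (u - t - 1) = v + (u - t - 1) + 1 by omega]
      exact h.next _ (by omega)

end IsWordChain

namespace IsSelfSimilarTree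

variable [MetricSpace X] {V : Set X} [CompactSpace X] [Finite ι]

theorem exists_isWordChain (h : IsSelfSimilarTree σ V) (k : ℕ) (a b : X) :
    ∃ R w, IsWordChain σ k a b R w := by
  have := h.preconnectedSpace
  set P : List ι → Prop := fun v => ∃ R w, IsWordChain σ k a (wordComp σ v a) R w ∧ w R = v with hP
  have hstep : ∀ v v' : List ι, P v → v'.length = k →
      (range (wordComp σ v) ∩ range (wordComp σ v')).Nonempty → P v' := by
    rintro v v' ⟨R, w, hw, rfl⟩ hv' hm
    refine ⟨R + 1, fun t => if t ≤ R then w t else v', ⟨fun t ht => ?_, ?_, ?_, fun t ht => ?_⟩, ?_⟩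
    · by_cases htR : t ≤ R
      · simpa only [htR, if_true] using hw.length t htR
      · simpa only [htR, if_false] using hv'
    · simpa using hw.first
    · simp
    · rcases (Nat.lt_succ_iff.1 ht).lt_or_eq with htR | rfl
      · rw [if_pos htR.le, if_pos (show t + 1 ≤ R from htR)]
        exact hw.next t htR
      · rw [if_pos le_rfl, if_neg (by omega)]
        exact hm
    · simp
  have hclosed : ∀ Q : List ι → Prop,
      IsClosed (⋃ v ∈ {v : List ι | v.length = k ∧ Q v}, range (wordComp σ v)) := fun Q =>
    ((List.finite_length_eq ι k).subset fun _ hv => hv.1).isClosed_biUnion fun v _ =>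
      (isCompact_range (h.continuous_wordComp v)).isClosed
  have hall : ∀ v : List ι, v.length = k → P v := by
    by_contra! hex
    obtain ⟨v, hv, hPv⟩ := hex
    obtain ⟨u, hu, hau⟩ := h.exists_wordComp_eq k a
    have hPu : P u := ⟨0, fun _ => u, ⟨fun _ _ => hu, hau, mem_range_self a, by simp⟩, rfl⟩
    obtain ⟨x, -, hx1, hx2⟩ := isPreconnected_closed_iff.1 (isPreconnected_univ (α := X)) _ _
      (hclosed P) (hclosed fun v => ¬ P v) (fun x _ => by
        obtain ⟨v, hv, hx⟩ := h.exists_wordComp_eq k x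
        by_cases hPv : P v
        · exact Or.inl (mem_biUnion (show v ∈ {v | _ ∧ _} from ⟨hv, hPv⟩) hx)
        · exact Or.inr (mem_biUnion (show v ∈ {v | _ ∧ _} from ⟨hv, hPv⟩) hx))
      ⟨a, trivial, mem_biUnion (show u ∈ {v | _ ∧ _} from ⟨hu, hPu⟩) hau⟩
      ⟨wordComp σ v a, trivial,
        mem_biUnion (show v ∈ {v | _ ∧ _} from ⟨hv, hPv⟩) (mem_range_self a)⟩
    obtain ⟨v₁, hv₁, hx1⟩ := mem_iUnion₂.1 hx1
    obtain ⟨v₂, hv₂, hx2⟩ := mem_iUnion₂.1 hx2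
    exact hv₂.2 (hstep v₁ v₂ hv₁.2 hv₂.1 ⟨x, hx1, hx2⟩)
  obtain ⟨v, hv, hbv⟩ := h.exists_wordComp_eq k b
  obtain ⟨R, w, hw, rfl⟩ := hall v hv
  exact ⟨R, w, hw.length, hw.first, hbv, hw.next⟩

/-- If the pieces of level `k` contain at most one vertex each, then two different vertices are
joined by a chain of at least two such pieces which meet only when they are consecutive. Each of
them is traversed from one vertex to another one. A shortest chain has these properties. -/
theorem exists_vertexChain (h : IsSelfSimilarTree σ V)
    (hk : ∀ w : List ι, w.length = k → ∀ x ∈ range (wordComp σ w), ∀ y ∈ range (wordComp σ w),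
      x ∈ V → y ∈ V → x = y) (ha : a ∈ V) (hb : b ∈ V) (hab : a ≠ b) :
    ∃ (R : ℕ) (w : ℕ → List ι) (p q : ℕ → X), 1 ≤ R ∧
      (∀ t ≤ R, (w t).length = k ∧ p t ∈ V ∧ q t ∈ V ∧ p t ≠ q t) ∧
      wordComp σ (w 0) (p 0) = a ∧
      (∀ t < R, wordComp σ (w t) (q t) = wordComp σ (w (t + 1)) (p (t + 1))) ∧
      wordComp σ (w R) (q R) = b ∧
      (∀ t < R, b ∉ range (wordComp σ (w t))) ∧
      (∀ t u, t + 1 < u → u ≤ R →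
        Disjoint (range (wordComp σ (w t))) (range (wordComp σ (w u)))) ∧
      ∀ t < R, ∀ x x', wordComp σ (w t) x = wordComp σ (w (t + 1)) x' → x = q t := by
  classical
  have hex := h.exists_isWordChain k a b
  obtain ⟨w, hw⟩ := Nat.find_spec hex
  set R := Nat.find hex with hRdef
  have hmin : ∀ {R' w'}, IsWordChain σ k a b R' w' → R ≤ R' := fun hc =>
    Nat.find_min' hex ⟨_, hc⟩
  have hbt : ∀ t < R, b ∉ range (wordComp σ (w t)) := fun t ht hbt =>
    absurd (hmin (hw.take ht.le hbt)) (by omega)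
  have hat : ∀ t ≤ R, 0 < t → a ∉ range (wordComp σ (w t)) := fun t ht h0 hat => by
    have := hmin (hw.drop ht hat)
    omega
  have hdisj : ∀ t u, t + 1 < u → u ≤ R →
      Disjoint (range (wordComp σ (w t))) (range (wordComp σ (w u))) := fun t u htu hu => by
    rw [disjoint_iff_inter_eq_empty, ← not_nonempty_iff_eq_empty]
    intro hm
    have := hmin (hw.shortcut htu hu hm)
    omega
  have hR : 1 ≤ R := by
    by_contra! h0
    have h0 : R = 0 := by omega
    exact hab (hk (w 0) (hw.length 0 (Nat.zero_le _)) a hw.first b (h0 ▸ hw.last) ha hb)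
  have hne : ∀ t < R, w t ≠ w (t + 1) := fun t ht heq => by
    rcases (show t + 1 ≤ R from ht).lt_or_eq with ht' | ht'
    · obtain ⟨x, hx, hx'⟩ := hw.next (t + 1) ht'
      exact disjoint_left.1 (hdisj t (t + 2) (by omega) ht') (heq ▸ hx) hx'
    · exact hbt t ht (heq ▸ ht' ▸ hw.last)
  have hlen : ∀ t < R, (w t).length = (w (t + 1)).length := fun t ht => by
    rw [hw.length t ht.le, hw.length (t + 1) ht]
  have : Nonempty X := ⟨a⟩
  choose! z hz hz' using hw.next
  have hp : ∀ t, ∃ p, t ≤ R → wordComp σ (w t) p = if t = 0 then a else z (t - 1) := fun t => by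
    by_cases ht : t ≤ R
    · rcases t with _ | t
      · exact hw.first.imp fun _ hx _ => by simpa using hx
      · exact (hz' t ht).imp fun _ hx _ => by simpa using hx
    · exact ⟨a, fun h' => absurd h' ht⟩
  have hq : ∀ t, ∃ q, t ≤ R → wordComp σ (w t) q = if t = R then b else z t := fun t => by
    by_cases ht : t ≤ R
    · rcases ht.lt_or_eq with ht | rfl
      · exact (hz t ht).imp fun _ hx _ => by simpa [ht.ne] using hx
      · exact hw.last.imp fun _ hx _ => by simpa using hx
    · exact ⟨a, fun h' => absurd h' ht⟩
  choose p hp using hp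
  choose q hq using hq
  have hp0 : wordComp σ (w 0) (p 0) = a := by simpa using hp 0 (Nat.zero_le _)
  have hqR : wordComp σ (w R) (q R) = b := by simpa using hq R le_rfl
  have hpq : ∀ t < R, wordComp σ (w t) (q t) = wordComp σ (w (t + 1)) (p (t + 1)) :=
    fun t ht => by rw [hq t ht.le, hp (t + 1) ht]; simp [ht.ne]
  refine ⟨R, w, p, q, hR, fun t ht => ⟨hw.length t ht, ?_, ?_, fun heq => ?_⟩, hp0, hpq, hqR, hbt,
    hdisj, fun t ht x x' hx => h.eq_of_wordComp_eq (hlen t ht) (hne t ht) hx (hpq t ht)⟩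
  · rcases t with _ | t
    · exact h.mem_of_wordComp_mem (hp0.symm ▸ ha)
    · exact h.mem_of_wordComp_eq (hlen t ht).symm (hne t ht).symm (hpq t ht).symm
  · rcases ht.lt_or_eq with ht | rfl
    · exact h.mem_of_wordComp_eq (hlen t ht) (hne t ht) (hpq t ht)
    · exact h.mem_of_wordComp_mem (hqR.symm ▸ hb)
  -- If a piece were entered and left at the same point, it could be omitted.
  · rcases t with _ | t
    · refine hat 1 hR one_pos ⟨p 1, ?_⟩
      rw [← hpq 0 hR, ← heq, hp0]
    · have h1 : wordComp σ (w (t + 1)) (q (t + 1)) ∈ range (wordComp σ (w t)) :=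
        ⟨q t, by rw [hpq t ht, heq]⟩
      rcases ht.lt_or_eq with ht | ht
      · exact disjoint_left.1 (hdisj t (t + 2) (by omega) ht) h1 ⟨p (t + 2), (hpq _ ht).symm⟩
      · exact hbt t ht.le (by rwa [ht, hqR] at h1)

end IsSelfSimilarTree

/-- In a self-similar tree `K` in a Banach space any two vertices are joined by an arc: the
self-similar paths along shortest chains of small pieces are injective. -/
theorem IsSelfSimilarTree.exists_arc {E : Type*} [NormedAddCommGroup E] [NormedSpace ℝ E]
    [CompleteSpace E] {ι : Type*} [Finite ι] {K : Set E} (hK : IsCompact K) {σ : ι → K → K}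
    {V : Set K} (h : IsSelfSimilarTree σ V) {S : List ι → E → E}
    (hS : ∀ w (x : K), S w x = wordComp σ w x) (hinj : ∀ w, Function.Injective (S w))
    (hc : ∀ w, w ≠ [] → ∃ ρ : ℝ, 0 ≤ ρ ∧ ρ < 1 ∧ ∀ x y, dist (S w x) (S w y) ≤ ρ * dist x y)
    {a b : K} (ha : a ∈ V) (hb : b ∈ V) (hab : a ≠ b) :
    ∃ g : C(unitInterval, E), Function.Injective g ∧ g 0 = a ∧ g 1 = b ∧ ∀ s, g s ∈ K := by
  have : CompactSpace K := isCompact_iff_compactSpace.1 hK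
  have hVfin : Finite V := h.finite
  -- Choose `k` such that the pieces of level `k` are too small to contain two vertices.
  obtain ⟨k, hk1, hk⟩ : ∃ k, 1 ≤ k ∧ ∀ w : List ι, w.length = k → ∀ x ∈ range (wordComp σ w),
      ∀ y ∈ range (wordComp σ w), x ∈ V → y ∈ V → x = y := by
    have : ∀ e : V × V, ∃ k₀, ∀ k, k₀ ≤ k → ∀ w : List ι, w.length = k → ∀ x y,
        wordComp σ w x = e.1 → wordComp σ w y = e.2 → e.1 = e.2 := fun e => by
      by_cases he : e.1 = e.2
      · exact ⟨0, fun _ _ _ _ _ _ _ _ => he⟩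
      · obtain ⟨k₀, hk₀⟩ := h.exists_small
          (dist_pos.2 fun h' => he (Subtype.ext h') : 0 < dist (e.1 : K) e.2)
        refine ⟨k₀, fun k hk w hw x y hx hy => absurd (hk₀ k hk w hw x y) ?_⟩
        rw [hx, hy]
        exact lt_irrefl _
    choose k₀ hk₀ using this
    obtain ⟨M, hM⟩ := (finite_range k₀).bddAbove
    refine ⟨max M 1, le_max_right _ _, ?_⟩
    rintro w hw _ ⟨x, rfl⟩ _ ⟨y, rfl⟩ hxV hyV
    exact congrArg Subtype.val <| hk₀ (⟨_, hxV⟩, ⟨_, hyV⟩) _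
      ((hM (mem_range_self _)).trans (le_max_left _ _)) w hw x y rfl rfl
  let J := {e : V × V // (e.1 : K) ≠ e.2}
  have hchain := fun e : J => h.exists_vertexChain hk e.1.1.2 e.1.2.2 e.2
  choose R w p q hR hwpq hfirst hnext hlast hend hdisj huniq using hchain
  have hsub : ∀ (e : J) (t : ℕ), ∃ e' : J, t ≤ R e → (e'.1.1 : K) = p e t ∧ (e'.1.2 : K) = q e t :=
    fun e t => by
      by_cases ht : t ≤ R e
      · obtain ⟨-, hp, hq, hne⟩ := hwpq e t ht
        exact ⟨⟨(⟨_, hp⟩, ⟨_, hq⟩), hne⟩, fun _ => ⟨rfl, rfl⟩⟩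
      · exact ⟨e, fun h' => absurd h' ht⟩
  choose sub hsub using hsub
  -- Words beyond the end of a chain are irrelevant; they are replaced by the last one.
  set f : J → ℕ → E → E := fun e t => S (w e (min t (R e))) with hf
  have hfw : ∀ e t, t ≤ R e → f e t = S (w e t) := fun e t ht => by
    rw [hf]; simp only [min_eq_left ht]
  have himage : ∀ v, S v '' K = (↑) '' range (wordComp σ v) := fun v => by
    ext x
    constructor
    · rintro ⟨y, hy, rfl⟩
      exact ⟨_, mem_range_self ⟨y, hy⟩, (hS v ⟨y, hy⟩).symm⟩
    · rintro ⟨-, ⟨y, rfl⟩, rfl⟩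
      exact ⟨y, y.2, hS v y⟩
  have hcontr : ∃ ρ : ℝ, 0 ≤ ρ ∧ ρ < 1 ∧
      ∀ e t x y, dist (f e t x) (f e t y) ≤ ρ * dist x y := by
    have hWfin : Finite {v : List ι | v.length = k} := List.finite_length_eq ι k
    have : ∀ v : {v : List ι | v.length = k}, ∃ ρ : ℝ, 0 ≤ ρ ∧ ρ < 1 ∧
        ∀ x y, dist (S v x) (S v y) ≤ ρ * dist x y := fun v => hc v fun h' => by
      have := v.2
      rw [mem_ofPred_eq, h', List.length_nil] at this
      omega
    choose ρ hρ0 hρ1 hρ using this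
    let e₀ : J := ⟨(⟨a, ha⟩, ⟨b, hb⟩), hab⟩
    have : Nonempty {v : List ι | v.length = k} := ⟨⟨w e₀ 0, (hwpq e₀ 0 (Nat.zero_le _)).1⟩⟩
    obtain ⟨v₀, hv₀⟩ := Finite.exists_max ρ
    refine ⟨ρ v₀, hρ0 _, hρ1 _, fun e t x y => ?_⟩
    refine (hρ ⟨_, (hwpq e (min t (R e)) (min_le_right _ _)).1⟩ x y).trans ?_
    exact mul_le_mul_of_nonneg_right (hv₀ _) dist_nonneg
  have hsys : IsPathSystem (fun e : J => ((e.1.1 : K) : E)) (fun e => ((e.1.2 : K) : E))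
      R f sub := by
    refine ⟨hcontr, fun e => ?_, fun e t ht => ?_, fun e => ?_⟩
    · rw [hfw e 0 (Nat.zero_le _), (hsub e 0 (Nat.zero_le _)).1, hS, hfirst]
    · rw [hfw e t ht.le, hfw e (t + 1) ht, (hsub e t ht.le).2, (hsub e (t + 1) ht).1, hS, hS,
        hnext e t ht]
    · rw [hfw e _ le_rfl, (hsub e _ le_rfl).2, hS, hlast]
  have : Finite J := inferInstance
  obtain ⟨γ, hγ⟩ := hsys.exists_isSelfSimilarPaths
  have hmem := hγ.mem hcontr hK.isClosed ⟨a, a.2⟩ fun e t ht x hx => by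
    rw [hfw e t ht]
    exact hS _ ⟨x, hx⟩ ▸ Subtype.coe_prop _
  have hγinj := hγ.injective hmem hR hsys.last (fun e t _ => hinj _)
    (fun e t ht => by
      rw [hfw e t ht.le, himage]
      rintro ⟨x, hx, hxe⟩
      exact hend e t ht (Subtype.ext hxe ▸ hx))
    (fun e t u htu hu => by
      rw [hfw e t (by omega), hfw e u hu, himage, himage]
      exact (disjoint_image_iff Subtype.val_injective).2 (hdisj e t u htu hu))
    (fun e t ht x hx x' hx' hxx => by
      rw [hfw e t ht.le, hfw e (t + 1) ht, hS _ ⟨x, hx⟩, hS _ ⟨x', hx'⟩] at hxx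
      rw [(hsub e t ht.le).2]
      exact congrArg Subtype.val (huniq e t ht ⟨x, hx⟩ ⟨x', hx'⟩ (Subtype.ext hxx)))
  let e₀ : J := ⟨(⟨a, ha⟩, ⟨b, hb⟩), hab⟩
  exact ⟨γ e₀, hγinj e₀, hγ.zero e₀, hγ.one e₀, hmem e₀⟩

end SelfSimilarTree

/-! ### Polygonal tree systems as self-similar trees -/

section Similarity

/-- A map that multiplies distances by `r` is, up to translation, `r` times a linear isometry. -/
theorem exists_linearIsometry_of_dist_eq {f : Plane → Plane} {r : ℝ} (hr : 0 < r)
    (hf : ∀ x y, dist (f x) (f y) = r * dist x y) :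
    ∃ L : Plane →ₗᵢ[ℝ] Plane, ∀ x y, f x - f y = r • L (x - y) := by
  have hg : Isometry fun x => r⁻¹ • f x := Isometry.of_dist_eq fun x y => by
    rw [dist_smul₀, hf, norm_inv, Real.norm_of_nonneg hr.le, inv_mul_cancel_left₀ hr.ne']
  refine ⟨hg.affineIsometryOfStrictConvexSpace.linearIsometry, fun x y => ?_⟩
  have := hg.affineIsometryOfStrictConvexSpace.map_vsub x y
  simp only [vsub_eq_sub, Isometry.affineIsometryOfStrictConvexSpace_apply] at this
  rw [this, ← smul_sub, smul_inv_smul₀ hr.ne']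

theorem map_combo_of_dist_eq {f : Plane → Plane} {r : ℝ} (hr : 0 < r)
    (hf : ∀ x y, dist (f x) (f y) = r * dist x y) {a b : ℝ} (hab : a + b = 1) (x y : Plane) :
    f (a • x + b • y) = a • f x + b • f y := by
  obtain ⟨L, hL⟩ := exists_linearIsometry_of_dist_eq hr hf
  have h1 := hL (a • x + b • y) y
  have h2 : a • x + b • y - y = a • (x - y) := by
    rw [← eq_sub_iff_add_eq'] at hab
    subst hab
    module
  rw [h2, map_smul, smul_comm, ← hL, sub_eq_iff_eq_add] at h1
  rw [h1, eq_sub_iff_add_eq'.2 hab]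
  module

theorem IsContractingSimilarity.injective {f : Plane → Plane} (hf : IsContractingSimilarity f) :
    Function.Injective f := by
  obtain ⟨r, hr, -, hd⟩ := hf
  intro x y hxy
  have := hd x y
  rw [hxy, dist_self] at this
  exact dist_eq_zero.1 ((mul_eq_zero.1 this.symm).resolve_left hr.ne')

theorem IsContractingSimilarity.continuous {f : Plane → Plane} (hf : IsContractingSimilarity f) :
    Continuous f := by
  obtain ⟨r, hr, -, hd⟩ := hf
  exact (LipschitzWith.of_dist_le_mul (K := ⟨r, hr.le⟩) fun x y => (hd x y).le).continuous

theorem exists_dist_wordMap_eq {m : ℕ} {S : Fin m → Plane → Plane}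
    (hS : ∀ i, IsContractingSimilarity (S i)) (w : List (Fin m)) :
    ∃ r : ℝ, 0 < r ∧ (w ≠ [] → r < 1) ∧ r ≤ 1 ∧
      ∀ x y, dist (wordMap S w x) (wordMap S w y) = r * dist x y := by
  induction w with
  | nil => exact ⟨1, one_pos, fun h => absurd rfl h, le_rfl, fun x y => (one_mul _).symm⟩
  | cons i w ih =>
    obtain ⟨r, hr0, -, hr1, hr⟩ := ih
    obtain ⟨q, hq0, hq1, hq⟩ := hS i
    have hlt : q * r < 1 := by nlinarith
    exact ⟨q * r, by positivity, fun _ => hlt, hlt.le, fun x y => by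
      rw [mul_assoc, ← hr]; exact hq _ _⟩

theorem injective_wordMap {m : ℕ} {S : Fin m → Plane → Plane}
    (hS : ∀ i, IsContractingSimilarity (S i)) (w : List (Fin m)) :
    Function.Injective (wordMap S w) := by
  induction w with
  | nil => exact Function.injective_id
  | cons i w ih => exact (hS i).injective.comp ih

/-- The maps that a system `S` induces on an invariant set. -/
def restrictSystem {m : ℕ} {T : Set Plane} {S : Fin m → Plane → Plane}
    (hT : ∀ i, MapsTo (S i) T T) (i : Fin m) : T → T := (hT i).restrict

theorem coe_wordComp_restrictSystem {m : ℕ} {T : Set Plane} {S : Fin m → Plane → Plane}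
    (hT : ∀ i, MapsTo (S i) T T) (w : List (Fin m)) (x : T) :
    (↑(wordComp (restrictSystem hT) w x) : Plane) = wordMap S w x := by
  induction w with
  | nil => rfl
  | cons i w ih => exact congrArg (S i) ih

end Similarity

section Lifting

/-- A map from a contractible space to the circle lifts to the line. -/
theorem exists_lift_of_contractibleSpace {X : Type*} [TopologicalSpace X] [ContractibleSpace X]
    (f : C(X, AddCircle (1 : ℝ))) :
    ∃ l : C(X, ℝ), ∀ x, (l x : AddCircle (1 : ℝ)) = f x := by
  obtain ⟨y, ⟨H⟩⟩ := id_nullhomotopic X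
  obtain ⟨e, he⟩ := QuotientAddGroup.mk_surjective (f y)
  let G : C(unitInterval × X, AddCircle (1 : ℝ)) := f.comp H.symm.toContinuousMap
  have hG0 : ∀ a, G (0, a) = ((ContinuousMap.const X e a : ℝ) : AddCircle (1 : ℝ)) := fun a => by
    change f (H.symm (0, a)) = _
    rw [H.symm.apply_zero]
    exact he.symm
  let l := (AddCircle.isCoveringMap_coe (1 : ℝ)).liftHomotopy G (ContinuousMap.const X e) hG0
  refine ⟨l.comp ((ContinuousMap.const X 1).prodMk (ContinuousMap.id X)), fun x => ?_⟩
  have h1 := congrFun ((AddCircle.isCoveringMap_coe (1 : ℝ)).liftHomotopy_lifts (H_0 := hG0)) (1, x)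
  refine h1.trans ?_
  change f (H.symm (1, x)) = _
  rw [H.symm.apply_one]
  rfl

end Lifting

theorem vertex_mem_polygon {n : ℕ} (A : Fin n → Plane) (a : Fin n) : A a ∈ polygon A :=
  subset_convexHull ℝ _ (mem_range_self a)

theorem isCompact_polygon {n : ℕ} (A : Fin n → Plane) : IsCompact (polygon A) :=
  (finite_range A).isCompact_convexHull ℝ

namespace IsConvexPolygon

variable {n : ℕ} [NeZero n] {A : Fin n → Plane}

/-- By the Krein–Milman theorem a vertex that were not extreme would lie in the convex hull of the
other vertices. -/
theorem mem_extremePoints (hA : IsConvexPolygon A) (a : Fin n) :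
    A a ∈ (polygon A).extremePoints ℝ := by
  by_contra hna
  have hsub : (polygon A).extremePoints ℝ ⊆ A '' {a}ᶜ := fun x hx => by
    obtain ⟨b, rfl⟩ := extremePoints_convexHull_subset hx
    refine ⟨b, ?_, rfl⟩
    rintro rfl
    exact hna hx
  have hcompact : IsCompact (polygon A) := (finite_range A).isCompact_convexHull ℝ
  have hKM := closure_convexHull_extremePoints hcompact (convex_convexHull ℝ _)
  have hcl : closure (convexHull ℝ ((polygon A).extremePoints ℝ)) ⊆ convexHull ℝ (A '' {a}ᶜ) :=
    closure_minimal (convexHull_mono hsub) ((toFinite _).isClosed_convexHull ℝ)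
  rw [hKM] at hcl
  exact hA.convexIndependent {a}ᶜ a (hcl (subset_convexHull ℝ _ (mem_range_self a))) rfl

end IsConvexPolygon

namespace IsPolygonalTreeSystem

variable {n m : ℕ} [NeZero n] {A : Fin n → Plane} {S : Fin m → Plane → Plane}

theorem mapsTo_polygon (hS : IsPolygonalTreeSystem A S) (i : Fin m) :
    MapsTo (S i) (polygon A) (polygon A) := mapsTo_iff_image_subset.2 (hS.subset i)

/-- Only vertices are mapped to vertices, as affine maps of the polygon into itself reflect
extreme points. -/
theorem mem_range_of_map_mem (hS : IsPolygonalTreeSystem A S) {i : Fin m} {x : Plane}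
    (hx : x ∈ polygon A) (h : S i x ∈ range A) : x ∈ range A := by
  obtain ⟨a, ha⟩ := h
  have hext := hS.isConvexPolygon.mem_extremePoints a
  obtain ⟨r, hr, -, hd⟩ := hS.isContractingSimilarity i
  refine extremePoints_convexHull_subset (mem_extremePoints.2 ⟨hx, fun p hp q hq hpq => ?_⟩)
  obtain ⟨s, t, hs, ht, hst, rfl⟩ := hpq
  have := (mem_extremePoints.1 hext).2 (S i p) (hS.mapsTo_polygon i hp) (S i q)
    (hS.mapsTo_polygon i hq) ⟨s, t, hs, ht, hst, by
      rw [ha, map_combo_of_dist_eq hr hd hst]⟩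
  have hinj := (hS.isContractingSimilarity i).injective
  exact ⟨hinj (this.1.trans ha), hinj (this.2.trans ha)⟩

/-- The pieces of a system meet in common vertices, at most one for each pair. (For disjoint pieces
the statement is vacuous, and `a`, `b` are arbitrary.) -/
theorem exists_vertices_of_eq (hS : IsPolygonalTreeSystem A S) {i j : Fin m} (hij : i ≠ j) :
    ∃ a b, ∀ x ∈ polygon A, ∀ x' ∈ polygon A, S i x = S j x' →
      x = A a ∧ x' = A b := by
  rcases hS.inter i j hij with h | ⟨a, b, hab, h⟩
  · refine ⟨0, 0, fun x hx x' hx' hxx => ?_⟩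
    have : S i x ∈ S i '' polygon A ∩ S j '' polygon A :=
      ⟨mem_image_of_mem _ hx, hxx ▸ mem_image_of_mem _ hx'⟩
    rw [h] at this
    exact absurd this (notMem_empty _)
  · refine ⟨a, b, fun x hx x' hx' hxx => ?_⟩
    have : S i x ∈ S i '' polygon A ∩ S j '' polygon A :=
      ⟨mem_image_of_mem _ hx, hxx ▸ mem_image_of_mem _ hx'⟩
    rw [h] at this
    have hxa : S i x = S i (A a) := this
    exact ⟨(hS.isContractingSimilarity i).injective hxa,
      (hS.isContractingSimilarity j).injective (by rw [← hxx, hxa, hab])⟩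

theorem meetsInVertices (hS : IsPolygonalTreeSystem A S) {T : Set Plane} (hT : T ⊆ polygon A)
    (hmaps : ∀ i, MapsTo (S i) T T) :
    MeetsInVertices (restrictSystem hmaps) {x : T | (x : Plane) ∈ range A} where
  injective i x y hxy := Subtype.ext
    ((hS.isContractingSimilarity i).injective (congrArg Subtype.val hxy))
  mem_of_eq i j x x' hij hx := by
    obtain ⟨a, b, hab⟩ := hS.exists_vertices_of_eq hij
    exact ⟨a, (hab x (hT x.2) x' (hT x'.2) (congrArg Subtype.val hx)).1.symm⟩
  eq_of_eq i j x x' z z' hij hx hz := by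
    obtain ⟨a, b, hab⟩ := hS.exists_vertices_of_eq hij
    exact Subtype.ext <| (hab x (hT x.2) x' (hT x'.2) (congrArg Subtype.val hx)).1.trans
      (hab z (hT z.2) z' (hT z'.2) (congrArg Subtype.val hz)).1.symm
  mem_of_map_mem i x hx := hS.mem_range_of_map_mem (hT x.2) hx

theorem exists_ratio (hS : IsPolygonalTreeSystem A S) :
    ∃ ρ : ℝ, 0 ≤ ρ ∧ ρ < 1 ∧ ∀ i x y, dist (S i x) (S i y) ≤ ρ * dist x y := by
  choose r hr0 hr1 hr using hS.isContractingSimilarity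
  obtain ⟨i₀, -⟩ := hS.vertex_mem 0
  have : Nonempty (Fin m) := ⟨i₀⟩
  obtain ⟨j, hj⟩ := Finite.exists_max r
  exact ⟨r j, (hr0 j).le, hr1 j, fun i x y => (hr i x y).le.trans
    (mul_le_mul_of_nonneg_right (hj i) dist_nonneg)⟩

variable {K : Set Plane}

theorem mapsTo_attractor (hK : IsAttractor S K) (i : Fin m) : MapsTo (S i) K K := fun x hx => by
  rw [hK.invariant]
  exact mem_iUnion.2 ⟨i, mem_image_of_mem _ hx⟩

theorem attractor_subset_polygon (hS : IsPolygonalTreeSystem A S) (hK : IsAttractor S K) :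
    K ⊆ polygon A := by
  obtain ⟨ρ, h0, h1, hρ⟩ := hS.exists_ratio
  refine subset_of_forall_exists_contraction hK.isCompact.isBounded (isCompact_polygon A).isClosed
    ⟨_, vertex_mem_polygon A 0⟩ h0 h1 fun z hz => ?_
  rw [hK.invariant] at hz
  obtain ⟨i, z', hz', rfl⟩ := mem_iUnion.1 hz
  exact ⟨S i, hρ i, hS.mapsTo_polygon i, z', hz', rfl⟩

theorem vertex_mem_attractor (hS : IsPolygonalTreeSystem A S) (hK : IsAttractor S K) (a : Fin n) :
    A a ∈ K := by
  obtain ⟨ρ, h0, h1, hρ⟩ := hS.exists_ratio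
  refine subset_of_forall_exists_contraction (finite_range A).isBounded hK.isCompact.isClosed
    hK.nonempty h0 h1 ?_ (mem_range_self a)
  rintro - ⟨b, rfl⟩
  obtain ⟨i, x, hx, hxb⟩ := hS.vertex_mem b
  exact ⟨S i, hρ i, mapsTo_attractor hK i, x, hS.mem_range_of_map_mem hx ⟨b, hxb.symm⟩, hxb⟩

/-- The intersection graph of the pieces is connected because the union of the pieces is. -/
theorem connected (hS : IsPolygonalTreeSystem A S) (c : Fin m → Prop)
    (hc : ∀ i j a b, S i (A a) = S j (A b) → (c i ↔ c j)) (i j : Fin m) : c i ↔ c j := by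
  have := hS.contractible
  have hpre : IsPreconnected (⋃ i, S i '' polygon A) :=
    isPreconnected_iff_preconnectedSpace.2 inferInstance
  have hcl : ∀ i, IsClosed (S i '' polygon A) := fun i =>
    ((isCompact_polygon A).image (hS.isContractingSimilarity i).continuous).isClosed
  have key : ∀ i j, c i → c j := by
    intro i j hi
    by_contra hj
    have hne : ∀ i, (S i '' polygon A).Nonempty := fun i => ⟨_, _, vertex_mem_polygon A 0, rfl⟩
    obtain ⟨x, -, h1, h2⟩ := isPreconnected_closed_iff.1 hpre
      (⋃ i ∈ {i | c i}, S i '' polygon A) (⋃ i ∈ {i | ¬ c i}, S i '' polygon A)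
      ((toFinite _).isClosed_biUnion fun i _ => hcl i)
      ((toFinite _).isClosed_biUnion fun i _ => hcl i)
      (fun x hx => by
        obtain ⟨i, hi⟩ := mem_iUnion.1 hx
        by_cases hci : c i
        · exact Or.inl (mem_biUnion (show i ∈ {i | c i} from hci) hi)
        · exact Or.inr (mem_biUnion (show i ∈ {i | ¬ c i} from hci) hi))
      ((hne i).imp fun x hx => ⟨mem_iUnion.2 ⟨i, hx⟩, mem_biUnion (show i ∈ {i | c i} from hi) hx⟩)
      ((hne j).imp fun x hx =>
        ⟨mem_iUnion.2 ⟨j, hx⟩, mem_biUnion (show j ∈ {i | ¬ c i} from hj) hx⟩)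
    obtain ⟨p, hp, z, hz, rfl⟩ := mem_iUnion₂.1 h1
    obtain ⟨q, hq, z', hz', hzz⟩ := mem_iUnion₂.1 h2
    have hpq : p ≠ q := by
      rintro rfl
      exact hq hp
    obtain ⟨a, b, hab⟩ := hS.exists_vertices_of_eq hpq
    obtain ⟨rfl, rfl⟩ := hab z hz z' hz' hzz.symm
    exact hq ((hc p q a b hzz.symm).1 hp)
  exact ⟨key i j, key j i⟩

/-- Functions on the pieces that fit together modulo integers at common vertices define a map from
the union of the pieces to the circle. As the union is contractible, the map lifts to the line. -/
theorem exists_integers (hS : IsPolygonalTreeSystem A S) (g : Fin m → C(Plane, ℝ))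
    (hg : ∀ i j a b, S i (A a) = S j (A b) → (g i (A a) : AddCircle (1 : ℝ)) = g j (A b)) :
    ∃ c : Fin m → ℤ, ∀ i j a b, S i (A a) = S j (A b) → g i (A a) + c i = g j (A b) + c j := by
  have := hS.contractible
  have hPc : CompactSpace (polygon A) := isCompact_iff_compactSpace.1 (isCompact_polygon A)
  have hPconn : IsPreconnected (univ : Set (polygon A)) :=
    (isPreconnected_iff_preconnectedSpace.1
      (convex_convexHull ℝ _).isPreconnected).isPreconnected_univ
  let p : Fin m → polygon A → (⋃ i, S i '' polygon A : Set Plane) := fun i x =>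
    ⟨S i x, mem_iUnion.2 ⟨i, mem_image_of_mem _ x.2⟩⟩
  have hp : ∀ i, Continuous (p i) := fun i =>
    ((hS.isContractingSimilarity i).continuous.comp continuous_subtype_val).subtype_mk _
  have hcov : ∀ x, ∃ i y, p i y = x := by
    rintro ⟨x, hx⟩
    obtain ⟨i, y, hy, rfl⟩ := mem_iUnion.1 hx
    exact ⟨i, ⟨y, hy⟩, rfl⟩
  choose I Y hIY using hcov
  have hf : ∀ i x, (g (I (p i x)) (Y (p i x)) : AddCircle (1 : ℝ)) = g i x := fun i x => by
    have hx : S (I (p i x)) (Y (p i x)) = S i x := congrArg Subtype.val (hIY (p i x))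
    by_cases hi : I (p i x) = i
    · rw [hi] at hx ⊢
      rw [(hS.isContractingSimilarity i).injective hx]
    · obtain ⟨a, b, hab⟩ := hS.exists_vertices_of_eq hi
      obtain ⟨ha, hb⟩ := hab _ (Y (p i x)).2 _ x.2 hx
      rw [ha, hb] at hx ⊢
      exact hg _ _ _ _ hx
  obtain ⟨l, hl⟩ := exists_lift_of_contractibleSpace
    ⟨fun x => (g (I x) (Y x) : AddCircle (1 : ℝ)), by
      refine continuous_of_finite_compact_cover hp (fun x => ⟨I x, Y x, hIY x⟩) fun i => ?_
      simp only [hf]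
      exact (AddCircle.continuous_mk' 1).comp ((g i).continuous.comp continuous_subtype_val)⟩
  have hlg : ∀ i x, (l (p i x) : AddCircle (1 : ℝ)) = g i x := fun i x => (hl _).trans (hf i x)
  let o : polygon A := ⟨A 0, vertex_mem_polygon A 0⟩
  have hint : ∀ i, ∃ c : ℤ, l (p i o) - g i o = c := fun i => by
    have h := hlg i o
    rw [← sub_eq_zero, ← AddCircle.coe_sub, AddCircle.coe_eq_zero_iff] at h
    obtain ⟨c, hc⟩ := h
    exact ⟨c, by simpa using hc.symm⟩
  choose c hc using hint
  have hall : ∀ i (x : polygon A), g i x + c i = l (p i x) := fun i x => by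
    have := hPconn.sub_eq_sub_of_coe_eq (f := fun x => l (p i x)) (g := fun x => g i x)
      (l.continuous.comp (hp i)).continuousOn
      ((g i).continuous.comp continuous_subtype_val).continuousOn
      (fun x _ => hlg i x) (mem_univ x) (mem_univ o)
    rw [← hc i, ← this]
    ring
  refine ⟨c, fun i j a b hab => ?_⟩
  have ha := hall i ⟨A a, vertex_mem_polygon A a⟩
  have hb := hall j ⟨A b, vertex_mem_polygon A b⟩
  have : p i ⟨A a, vertex_mem_polygon A a⟩ = p j ⟨A b, vertex_mem_polygon A b⟩ := Subtype.ext hab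
  rw [this] at ha
  exact ha.trans hb.symm

/-- The functions on `K` to be adjusted by integers are extended to the plane by Tietze's theorem,
so that the contractible union of the polygons can be used. -/
theorem isSelfSimilarTree (hS : IsPolygonalTreeSystem A S) (hK : IsAttractor S K) :
    IsSelfSimilarTree (restrictSystem (mapsTo_attractor hK)) {x : K | (x : Plane) ∈ range A} where
  toMeetsInVertices := hS.meetsInVertices (hS.attractor_subset_polygon hK) _
  finite := (finite_range A).preimage Subtype.val_injective.injOn
  contracting := by
    obtain ⟨ρ, h0, h1, hρ⟩ := hS.exists_ratio
    exact ⟨ρ, h0, h1, fun i x y => hρ i x y⟩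
  exists_eq x := by
    obtain ⟨i, z, hz, hzx⟩ := mem_iUnion.1 (hK.invariant.subset x.2)
    exact ⟨i, ⟨z, hz⟩, Subtype.ext hzx⟩
  connected c hc := hS.connected c fun i j a b hab =>
    hc i j ⟨A a, hS.vertex_mem_attractor hK a⟩ ⟨A b, hS.vertex_mem_attractor hK b⟩
      (Subtype.ext hab)
  lift h hh := by
    have hKP := hS.attractor_subset_polygon hK
    choose g hg using fun i => (h i).exists_restrict_eq hK.isCompact.isClosed
    have hgx : ∀ i (x : K), g i x = h i x := fun i x => congrArg (fun f => f x) (hg i)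
    obtain ⟨c, hc⟩ := hS.exists_integers g fun i j a b hab => by
      have := hh i j ⟨A a, hS.vertex_mem_attractor hK a⟩ ⟨A b, hS.vertex_mem_attractor hK b⟩
        (Subtype.ext hab)
      rwa [← hgx, ← hgx] at this
    refine ⟨c, fun i j x x' hx => ?_⟩
    have hxx : S i x = S j x' := congrArg Subtype.val hx
    by_cases hij : i = j
    · subst hij
      rw [Subtype.ext ((hS.isContractingSimilarity i).injective hxx)]
    · obtain ⟨a, b, hab⟩ := hS.exists_vertices_of_eq hij
      obtain ⟨ha, hb⟩ := hab x (hKP x.2) x' (hKP x'.2) hxx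
      rw [← hgx, ← hgx, ha, hb]
      exact hc i j a b (by rw [← ha, ← hb]; exact hxx)

end IsPolygonalTreeSystem

/-! ### Directions in the plane -/

section Directions

open Real

/-- The unit vector of the plane with direction `φ`. -/
noncomputable def unitVector (φ : ℝ) : Plane := !₂[cos φ, sin φ]

theorem exists_eq_smul_unitVector (p : Plane) : ∃ φ, p = ‖p‖ • unitVector φ := by
  refine ⟨Complex.arg ⟨p 0, p 1⟩, ?_⟩
  have hn : ‖(⟨p 0, p 1⟩ : ℂ)‖ = ‖p‖ := by
    rw [EuclideanSpace.norm_eq, Fin.sum_univ_two, Complex.norm_eq_sqrt_sq_add_sq]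
    simp
  rw [← hn]
  ext i
  fin_cases i
  · simp [unitVector, Complex.norm_mul_cos_arg]
  · simp [unitVector, Complex.norm_mul_sin_arg]

theorem norm_unitVector (φ : ℝ) : ‖unitVector φ‖ = 1 := by
  rw [EuclideanSpace.norm_eq, Fin.sum_univ_two]
  simp [unitVector]

theorem inner_unitVector (α β : ℝ) : inner ℝ (unitVector α) (unitVector β) = cos (β - α) := by
  simp [unitVector, PiLp.inner_apply, Fin.sum_univ_two, cos_sub]

theorem unitVector_add_int_mul (φ : ℝ) (k : ℤ) : unitVector (φ + k * (2 * π)) = unitVector φ := by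
  simp [unitVector, cos_add_int_mul_two_pi, sin_add_int_mul_two_pi]

theorem sin_smul_unitVector (θ μ τ : ℝ) : sin θ • unitVector (μ + τ) =
    sin (θ / 2 - τ) • unitVector (μ - θ / 2) + sin (θ / 2 + τ) • unitVector (μ + θ / 2) := by
  have hs : sin θ = 2 * sin (θ / 2) * cos (θ / 2) := by
    rw [← sin_two_mul]; ring_nf
  ext i
  fin_cases i
  · simp only [unitVector, hs]
    simp [sin_sub, sin_add, cos_add, cos_sub]
    ring
  · simp only [unitVector, hs]
    simp [sin_sub, sin_add, cos_add, cos_sub]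
    ring

/-- Two directions enclosing the angle `θ` are the end points of an arc of directions of
length `θ`. -/
theorem exists_unitVector_eq {p q : Plane} (hp : p ≠ 0) (hq : q ≠ 0) :
    ∃ μ, (p = ‖p‖ • unitVector (μ - InnerProductGeometry.angle p q / 2) ∧
        q = ‖q‖ • unitVector (μ + InnerProductGeometry.angle p q / 2)) ∨
      (q = ‖q‖ • unitVector (μ - InnerProductGeometry.angle p q / 2) ∧
        p = ‖p‖ • unitVector (μ + InnerProductGeometry.angle p q / 2)) := by
  obtain ⟨α, hα⟩ := exists_eq_smul_unitVector p
  obtain ⟨β, hβ⟩ := exists_eq_smul_unitVector q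
  set θ := InnerProductGeometry.angle p q with hθ
  have hcos : cos θ = cos (β - α) := by
    rw [hθ, hα, hβ, InnerProductGeometry.angle_smul_left_of_pos _ _ (norm_pos_iff.2 hp),
      InnerProductGeometry.angle_smul_right_of_pos _ _ (norm_pos_iff.2 hq),
      InnerProductGeometry.cos_angle, norm_unitVector, norm_unitVector, inner_unitVector]
    simp
  obtain ⟨k, hk | hk⟩ := cos_eq_cos_iff.1 hcos
  · refine ⟨α + θ / 2, Or.inl ⟨by rw [add_sub_cancel_right]; exact hα, ?_⟩⟩
    rw [← unitVector_add_int_mul _ k]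
    rwa [show α + θ / 2 + θ / 2 + k * (2 * π) = β by linarith]
  · refine ⟨α - θ / 2, Or.inr ⟨?_, by rw [sub_add_cancel]; exact hα⟩⟩
    rw [← unitVector_add_int_mul _ k]
    rwa [show α - θ / 2 - θ / 2 + k * (2 * π) = β by linarith]

/-- A convex set containing `y`, `y + p` and `y + q` extends from `y` in all directions of an arc
whose length is the angle between `p` and `q`. -/
theorem Convex.exists_arc_of_directions {Q : Set Plane} (hQ : Convex ℝ Q) {y p q : Plane}
    (hy : y ∈ Q) (hyp : y + p ∈ Q) (hyq : y + q ∈ Q) (hp : p ≠ 0) (hq : q ≠ 0)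
    (hpos : 0 < InnerProductGeometry.angle p q) (hlt : InnerProductGeometry.angle p q < π) :
    ∃ μ, ∀ τ, |τ| ≤ InnerProductGeometry.angle p q / 2 →
      ∃ t : ℝ, 0 < t ∧ y + t • unitVector (μ + τ) ∈ Q := by
  have key : ∀ {p q : Plane} {θ μ τ : ℝ}, y + p ∈ Q → y + q ∈ Q → p ≠ 0 → q ≠ 0 → 0 < θ → θ < π →
      |τ| ≤ θ / 2 → p = ‖p‖ • unitVector (μ - θ / 2) → q = ‖q‖ • unitVector (μ + θ / 2) →
      ∃ t : ℝ, 0 < t ∧ y + t • unitVector (μ + τ) ∈ Q := by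
    intro p q θ μ τ hyp hyq hp hq hpos hlt hτ hpe hqe
    obtain ⟨h1, h2⟩ := abs_le.1 hτ
    have hs := sin_pos_of_pos_of_lt_pi hpos hlt
    set c := sin (θ / 2 - τ) / (sin θ * ‖p‖) with hc
    set d := sin (θ / 2 + τ) / (sin θ * ‖q‖) with hd
    have hp' := norm_pos_iff.2 hp
    have hq' := norm_pos_iff.2 hq
    have hc0 : 0 ≤ c := div_nonneg
      (sin_nonneg_of_nonneg_of_le_pi (by linarith) (by linarith)) (by positivity)
    have hd0 : 0 ≤ d := div_nonneg
      (sin_nonneg_of_nonneg_of_le_pi (by linarith) (by linarith)) (by positivity)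
    have he : unitVector (μ + τ) = c • p + d • q := by
      have hcp : sin θ • c • p = sin (θ / 2 - τ) • unitVector (μ - θ / 2) := by
        calc _ = (sin θ * c * ‖p‖) • unitVector (μ - θ / 2) := by
              rw [mul_smul, mul_smul, ← hpe]
          _ = _ := by congr 1; rw [hc]; field_simp
      have hdq : sin θ • d • q = sin (θ / 2 + τ) • unitVector (μ + θ / 2) := by
        calc _ = (sin θ * d * ‖q‖) • unitVector (μ + θ / 2) := by
              rw [mul_smul, mul_smul, ← hqe]
          _ = _ := by congr 1; rw [hd]; field_simp
      have h3 := sin_smul_unitVector θ μ τ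
      have h4 : sin θ • (c • p + d • q) = sin θ • unitVector (μ + τ) := by
        rw [h3]
        rw [smul_add, hcp, hdq]
      exact (smul_right_injective _ hs.ne' h4).symm
    refine ⟨1 / (c + d + 1), by positivity, ?_⟩
    have hmem := hQ.sum_mem (t := Finset.univ) (w := ![1 / (c + d + 1), c / (c + d + 1),
      d / (c + d + 1)]) (z := ![y, y + p, y + q]) (by
        intro i _
        fin_cases i
        · exact div_nonneg zero_le_one (by positivity)
        · exact div_nonneg hc0 (by positivity)
        · exact div_nonneg hd0 (by positivity)) (by
        simp only [Fin.sum_univ_three, Matrix.cons_val]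
        field_simp
        ring) (by
        intro i _
        fin_cases i
        · exact hy
        · exact hyp
        · exact hyq)
    convert hmem using 1
    simp only [Fin.sum_univ_three, Matrix.cons_val]
    rw [he]
    have h1 : 1 / (c + d + 1) + c / (c + d + 1) + d / (c + d + 1) = 1 := by field_simp; ring
    have h2 : c / (c + d + 1) = 1 / (c + d + 1) * c := by ring
    have h3 : d / (c + d + 1) = 1 / (c + d + 1) * d := by ring
    rw [h2, h3] at h1 ⊢
    set e := 1 / (c + d + 1)
    calc _ = (e + e * c + e * d) • y + e • (c • p + d • q) := by rw [h1, one_smul]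
      _ = _ := by module
  obtain ⟨μ, ⟨h1, h2⟩ | ⟨h1, h2⟩⟩ := exists_unitVector_eq hp hq
  · exact ⟨μ, fun τ hτ => key hyp hyq hp hq hpos hlt hτ h1 h2⟩
  · exact ⟨μ, fun τ hτ => key hyq hyp hq hp hpos hlt hτ h1 h2⟩

open MeasureTheory in
/-- Convex sets that meet only at `y` and extend from `y` in the directions of arcs of length `θ`
occupy disjoint closed arcs of the circle of directions. Disjoint closed arcs do not cover the
circle, so the inequality is strict. -/
theorem card_mul_lt_two_pi {ι : Type*} [Fintype ι] [Nontrivial ι] {Q : ι → Set Plane}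
    {y : Plane} {θ : ℝ} {μ : ι → ℝ} (hθ : 0 < θ) (hθπ : θ ≤ π) (hQ : ∀ i, Convex ℝ (Q i))
    (hy : ∀ i, y ∈ Q i) (hinter : ∀ i j, i ≠ j → Q i ∩ Q j ⊆ {y})
    (hμ : ∀ i τ, |τ| ≤ θ / 2 → ∃ t : ℝ, 0 < t ∧ y + t • unitVector (μ i + τ) ∈ Q i) :
    Fintype.card ι * θ < 2 * π := by
  have hfact : Fact (0 < 2 * π) := ⟨two_pi_pos⟩
  let B : ι → Set (AddCircle (2 * π)) := fun i =>
    Metric.closedBall (μ i : AddCircle (2 * π)) (θ / 2)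
  -- A common direction would give a common point near `y`, the sets being star-shaped about `y`.
  have hdisj : Pairwise (Function.onFun Disjoint B) := by
    intro i j hij
    refine disjoint_left.2 fun z hzi hzj => ?_
    have hrep : ∀ i, z ∈ B i → ∃ τ, |τ| ≤ θ / 2 ∧ z = ((μ i + τ : ℝ) : AddCircle (2 * π)) := by
      intro i hi
      obtain ⟨r, hr⟩ := QuotientAddGroup.mk_surjective (z - (μ i : AddCircle (2 * π)))
      have hn : ‖z - (μ i : AddCircle (2 * π))‖ ≤ θ / 2 := by
        rw [← dist_eq_norm]; exact hi
      rw [← hr] at hn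
      change ‖(r : AddCircle (2 * π))‖ ≤ θ / 2 at hn
      rw [AddCircle.norm_eq] at hn
      refine ⟨_, hn, ?_⟩
      have h0 : ((round ((2 * π)⁻¹ * r) * (2 * π) : ℝ) : AddCircle (2 * π)) = 0 :=
        (AddCircle.coe_eq_zero_iff _).2 ⟨_, zsmul_eq_mul _ _⟩
      rw [AddCircle.coe_add, AddCircle.coe_sub, h0, sub_zero]
      change z = (μ i : AddCircle (2 * π)) + (QuotientAddGroup.mk r : AddCircle (2 * π))
      rw [hr, add_sub_cancel]
    obtain ⟨τ, hτ, hzτ⟩ := hrep i hzi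
    obtain ⟨τ', hτ', hzτ'⟩ := hrep j hzj
    obtain ⟨t, ht, htQ⟩ := hμ i τ hτ
    obtain ⟨t', ht', htQ'⟩ := hμ j τ' hτ'
    have hdir : unitVector (μ j + τ') = unitVector (μ i + τ) := by
      have h := hzτ'.symm.trans hzτ
      rw [← sub_eq_zero, ← AddCircle.coe_sub, AddCircle.coe_eq_zero_iff] at h
      obtain ⟨k, hk⟩ := h
      rw [zsmul_eq_mul] at hk
      rw [← unitVector_add_int_mul (μ i + τ) k, hk]
      congr 1
      ring
    rw [hdir] at htQ'
    have hshrink : ∀ {Q : Set Plane} {s t : ℝ}, Convex ℝ Q → y ∈ Q → 0 < s → s ≤ t →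
        y + t • unitVector (μ i + τ) ∈ Q → y + s • unitVector (μ i + τ) ∈ Q := by
      intro Q s t hQ hy hs hst hmem
      have ht : 0 < t := hs.trans_le hst
      have := hQ.add_smul_mem hy hmem (t := s / t) ⟨by positivity, (div_le_one ht).2 hst⟩
      rwa [smul_smul, div_mul_cancel₀ _ ht.ne'] at this
    have hpos : 0 < min t t' := lt_min ht ht'
    have hmem := hinter i j hij
      ⟨hshrink (hQ i) (hy i) hpos (min_le_left _ _) htQ,
        hshrink (hQ j) (hy j) hpos (min_le_right _ _) htQ'⟩
    have hz : min t t' • unitVector (μ i + τ) = 0 := by simpa using hmem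
    have := congrArg norm hz
    rw [norm_smul, norm_unitVector, norm_zero, mul_one, norm_eq_zero] at this
    exact hpos.ne' this
  have hmeas : ∀ i, MeasurableSet (B i) := fun i => Metric.isClosed_closedBall.measurableSet
  have hcl : IsClosed (⋃ i, B i) := isClosed_iUnion_of_finite fun i => Metric.isClosed_closedBall
  -- If the arcs covered the connected circle, each of them would be clopen.
  have hne : ((⋃ i, B i)ᶜ).Nonempty := by
    by_contra h
    rw [not_nonempty_iff_eq_empty, compl_empty_iff] at h
    obtain ⟨i, j, hij⟩ := exists_pair_ne ι
    have hself : ∀ i, (μ i : AddCircle (2 * π)) ∈ B i := fun i =>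
      Metric.mem_closedBall_self (by positivity)
    have hopen : IsOpen (B i) := by
      have : B i = (⋃ k ∈ {k | k ≠ i}, B k)ᶜ := by
        ext z
        simp only [mem_compl_iff, mem_iUnion, not_exists]
        constructor
        · exact fun hz k hk hzk => disjoint_left.1 (hdisj hk) hzk hz
        · intro hz
          obtain ⟨k, hk⟩ := mem_iUnion.1 (h ▸ mem_univ z)
          by_cases hki : k = i
          · exact hki ▸ hk
          · exact absurd hk (hz k hki)
      rw [this]
      exact ((toFinite _).isClosed_biUnion fun k _ => Metric.isClosed_closedBall).isOpen_compl
    have huniv : B i = univ :=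
      IsClopen.eq_univ ⟨Metric.isClosed_closedBall, hopen⟩ ⟨_, hself i⟩
    exact disjoint_left.1 (hdisj hij) (huniv ▸ mem_univ _) (hself j)
  have hpos : 0 < volume (⋃ i, B i)ᶜ := hcl.isOpen_compl.measure_pos _ hne
  have hvol : volume (⋃ i, B i) = ENNReal.ofReal (Fintype.card ι * θ) := by
    rw [measure_iUnion hdisj hmeas, tsum_fintype]
    have hB : ∀ i, volume (B i) = ENNReal.ofReal θ := fun i => by
      rw [AddCircle.volume_closedBall, mul_div_cancel₀ _ two_ne_zero, min_eq_right (by linarith)]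
    simp only [hB, Finset.sum_const, Finset.card_univ, nsmul_eq_mul]
    rw [ENNReal.ofReal_mul (by positivity), ENNReal.ofReal_natCast]
  have htot : volume (⋃ i, B i) + volume (⋃ i, B i)ᶜ = ENNReal.ofReal (2 * π) := by
    rw [measure_add_measure_compl hcl.measurableSet, AddCircle.measure_univ]
  have hlt : volume (⋃ i, B i) < ENNReal.ofReal (2 * π) := by
    rw [← htot]
    exact ENNReal.lt_add_right (by rw [hvol]; exact ENNReal.ofReal_ne_top) hpos.ne'
  rw [hvol] at hlt
  exact (ENNReal.ofReal_lt_ofReal_iff two_pi_pos).1 hlt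

end Directions

/-! ### Pieces at a common vertex, and the main tree -/

namespace IsConvexPolygon

variable {n : ℕ} [NeZero n] {A : Fin n → Plane}

theorem not_wbtw (hA : IsConvexPolygon A) {i j k : Fin n} (hij : j ≠ i) (hik : k ≠ i) :
    ¬ Wbtw ℝ (A j) (A i) (A k) := fun h => by
  have hmem : A i ∈ convexHull ℝ (A '' {j, k}) := by
    rw [image_pair, convexHull_pair]
    exact mem_segment_iff_wbtw.2 h
  rcases hA.convexIndependent _ _ hmem with h | h
  · exact hij h.symm
  · exact hik h.symm

theorem neighbors_ne (hA : IsConvexPolygon A) (i : Fin n) :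
    i - 1 ≠ i ∧ i + 1 ≠ i ∧ i - 1 ≠ i + 1 := by
  have hn := hA.three_le
  have h1 : ((1 : Fin n) : ℕ) = 1 := by
    rw [Fin.val_one', Nat.mod_eq_of_lt (by omega)]
  have h1ne : (1 : Fin n) ≠ 0 := fun h => by simp [h] at h1
  refine ⟨fun h => h1ne (sub_eq_self.1 h), fun h => h1ne (left_eq_add.1 h.symm), fun h => ?_⟩
  have h2 : (1 : Fin n) + 1 = 0 := by
    have := sub_eq_iff_eq_add.1 h
    rw [add_assoc] at this
    exact left_eq_add.1 this
  have h3 := congrArg Fin.val h2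
  rw [Fin.val_add, h1, Nat.mod_eq_of_lt (by omega)] at h3
  simp at h3

theorem vertexAngle_pos (hA : IsConvexPolygon A) (i : Fin n) : 0 < vertexAngle A i := by
  obtain ⟨h1, h2, h3⟩ := hA.neighbors_ne i
  refine lt_of_le_of_ne (EuclideanGeometry.angle_nonneg _ _ _) fun h => ?_
  rcases EuclideanGeometry.angle_eq_zero_iff_ne_and_wbtw.1 h.symm with ⟨-, h⟩ | ⟨-, h⟩
  · exact hA.not_wbtw h1.symm h3.symm h
  · exact hA.not_wbtw h2.symm h3 h

theorem vertexAngle_lt_pi (hA : IsConvexPolygon A) (i : Fin n) : vertexAngle A i < Real.pi := by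
  obtain ⟨h1, h2, -⟩ := hA.neighbors_ne i
  refine lt_of_le_of_ne (EuclideanGeometry.angle_le_pi _ _ _) fun h => ?_
  exact hA.not_wbtw h1 h2 (EuclideanGeometry.angle_eq_pi_iff_sbtw.1 h).wbtw

theorem minVertexAngle_le (A : Fin n → Plane) (i : Fin n) : minVertexAngle A ≤ vertexAngle A i :=
  ciInf_le (finite_range _).bddBelow i

theorem minVertexAngle_pos (hA : IsConvexPolygon A) : 0 < minVertexAngle A := by
  obtain ⟨i, hi⟩ := exists_eq_ciInf_of_finite (f := vertexAngle A)
  exact (hA.vertexAngle_pos i).trans_eq hi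

theorem minVertexAngle_lt_pi (hA : IsConvexPolygon A) : minVertexAngle A < Real.pi :=
  (minVertexAngle_le A 0).trans_lt (hA.vertexAngle_lt_pi 0)

end IsConvexPolygon

theorem arc_subset_mainTree {n : ℕ} {A : Fin n → Plane} {K : Set Plane} {a b : Fin n}
    (hab : a ≠ b) {g : C(unitInterval, Plane)} (hg : Function.Injective g)
    (h0 : g 0 = A a) (h1 : g 1 = A b) (hgK : ∀ s, g s ∈ K)
    (s : unitInterval) : g s ∈ mainTree A K :=
  ⟨a, b, hab, range g, ⟨g, g.continuous, hg, h0, h1, rfl⟩, range_subset_iff.2 hgK,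
    mem_range_self s⟩

theorem mainTree_subset {n : ℕ} (A : Fin n → Plane) (K : Set Plane) : mainTree A K ⊆ K := by
  rintro x ⟨i, j, -, L, -, hL, hx⟩
  exact hL hx

namespace IsPolygonalTreeSystem

variable {n m : ℕ} [NeZero n] {A : Fin n → Plane} {S : Fin m → Plane → Plane} {K : Set Plane}

/-- Two different pieces of the same level that have a common point meet nowhere else, and the
point is a vertex of both. -/
theorem inter_image_polygon (hS : IsPolygonalTreeSystem A S) {v w : List (Fin m)}
    (hlen : v.length = w.length) (hne : v ≠ w) {y : Plane} (hv : y ∈ wordMap S v '' polygon A)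
    (hw : y ∈ wordMap S w '' polygon A) :
    wordMap S v '' polygon A ∩ wordMap S w '' polygon A = {y} ∧ ∃ a, wordMap S v (A a) = y := by
  have hM := hS.meetsInVertices Subset.rfl hS.mapsTo_polygon
  have hcoe := coe_wordComp_restrictSystem hS.mapsTo_polygon
  obtain ⟨p, hp, rfl⟩ := hv
  obtain ⟨q, hq, hpq⟩ := hw
  have hpq' : wordComp (restrictSystem hS.mapsTo_polygon) v ⟨p, hp⟩ =
      wordComp (restrictSystem hS.mapsTo_polygon) w ⟨q, hq⟩ :=
    Subtype.ext (by rw [hcoe, hcoe]; exact hpq.symm)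
  refine ⟨Subset.antisymm ?_ (singleton_subset_iff.2 ⟨⟨p, hp, rfl⟩, q, hq, hpq⟩), ?_⟩
  · rintro x ⟨⟨z, hz, rfl⟩, z', hz', hzz⟩
    have hzz' : wordComp (restrictSystem hS.mapsTo_polygon) v ⟨z, hz⟩ =
        wordComp (restrictSystem hS.mapsTo_polygon) w ⟨z', hz'⟩ :=
      Subtype.ext (by rw [hcoe, hcoe]; exact hzz.symm)
    have : z = p := congrArg Subtype.val (hM.eq_of_wordComp_eq hlen hne hzz' hpq')
    rw [this, mem_singleton_iff]
  · obtain ⟨a, ha⟩ : p ∈ range A := hM.mem_of_wordComp_eq hlen hne hpq'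
    exact ⟨a, by rw [ha]⟩

theorem convex_image_polygon (hS : IsPolygonalTreeSystem A S) (w : List (Fin m)) :
    Convex ℝ (wordMap S w '' polygon A) := by
  obtain ⟨r, hr, -, -, hd⟩ := exists_dist_wordMap_eq hS.isContractingSimilarity w
  rintro - ⟨x, hx, rfl⟩ - ⟨y, hy, rfl⟩ a b ha hb hab
  exact ⟨a • x + b • y, convex_convexHull ℝ _ hx hy ha hb hab, map_combo_of_dist_eq hr hd hab x y⟩

/-- A piece extends from each of its vertices in the directions of an arc whose length is the
minimal vertex angle. -/
theorem exists_arc_of_directions (hS : IsPolygonalTreeSystem A S) (w : List (Fin m)) (a : Fin n) :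
    ∃ μ, ∀ τ, |τ| ≤ minVertexAngle A / 2 → ∃ t : ℝ, 0 < t ∧
      wordMap S w (A a) + t • unitVector (μ + τ) ∈ wordMap S w '' polygon A := by
  have hA := hS.isConvexPolygon
  obtain ⟨r, hr, -, -, hd⟩ := exists_dist_wordMap_eq hS.isContractingSimilarity w
  obtain ⟨L, hL⟩ := exists_linearIsometry_of_dist_eq hr hd
  obtain ⟨h1, h2, -⟩ := hA.neighbors_ne a
  have hinj := hA.convexIndependent.injective
  have hang : InnerProductGeometry.angle (r • L (A (a - 1) - A a)) (r • L (A (a + 1) - A a)) =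
      vertexAngle A a := by
    rw [InnerProductGeometry.angle_smul_smul hr.ne', L.angle_map]
    rfl
  have hne : ∀ b, b ≠ a → r • L (A b - A a) ≠ 0 := fun b hb =>
    smul_ne_zero hr.ne' (L.injective.ne (sub_ne_zero.2 (hinj.ne hb)) |>.trans_eq L.map_zero)
  have hmem : ∀ b, wordMap S w (A a) + r • L (A b - A a) ∈ wordMap S w '' polygon A := fun b => by
    rw [← hL, add_sub_cancel]
    exact mem_image_of_mem _ (vertex_mem_polygon A b)
  obtain ⟨μ, hμ⟩ := (hS.convex_image_polygon w).exists_arc_of_directions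
    (mem_image_of_mem _ (vertex_mem_polygon A a)) (hmem (a - 1)) (hmem (a + 1)) (hne _ h1)
    (hne _ h2) (by rw [hang]; exact hA.vertexAngle_pos a)
    (by rw [hang]; exact hA.vertexAngle_lt_pi a)
  refine ⟨μ, fun τ hτ => hμ τ (hτ.trans ?_)⟩
  rw [hang]
  have := IsConvexPolygon.minVertexAngle_le A a
  linarith

theorem mem_image_polygon (hS : IsPolygonalTreeSystem A S) (hK : IsAttractor S K) {y : K}
    {k : ℕ} {w : List (Fin m)}
    (hw : w ∈ wordsThrough (restrictSystem (mapsTo_attractor hK)) k y) :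
    (y : Plane) ∈ wordMap S w '' polygon A := by
  obtain ⟨-, x, rfl⟩ := hw
  exact ⟨x, hS.attractor_subset_polygon hK x.2,
    (coe_wordComp_restrictSystem (mapsTo_attractor hK) w x).symm⟩

/-- The pieces of a given level that contain `y` are convex and, if there are several, meet only
at their common vertex `y`, where each has at least the minimal angle; so there are less than
`2π` divided by this angle of them. -/
theorem ncard_wordsThrough_le (hS : IsPolygonalTreeSystem A S) (hK : IsAttractor S K) (k : ℕ)
    (y : K) : (wordsThrough (restrictSystem (mapsTo_attractor hK)) k y).ncard ≤
      ⌈2 * Real.pi / minVertexAngle A⌉₊ - 1 := by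
  have hA := hS.isConvexPolygon
  have hpos := hA.minVertexAngle_pos
  have hpi := hA.minVertexAngle_lt_pi
  set T := wordsThrough (restrictSystem (mapsTo_attractor hK)) k y with hT
  have hfin : T.Finite := finite_wordsThrough _ k y
  suffices h : (T.ncard : ℝ) * minVertexAngle A < 2 * Real.pi by
    have : (T.ncard : ℝ) < ⌈2 * Real.pi / minVertexAngle A⌉₊ :=
      ((lt_div_iff₀ hpos).2 h).trans_le (Nat.le_ceil _)
    have : T.ncard < ⌈2 * Real.pi / minVertexAngle A⌉₊ := by exact_mod_cast this
    omega
  -- A single piece need not have `y` as a vertex; the bound is then `π < 2π`.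
  by_cases h1 : T.ncard ≤ 1
  · have h1' : (T.ncard : ℝ) ≤ 1 := by exact_mod_cast h1
    have := Real.pi_pos
    nlinarith
  have : Fintype T := hfin.fintype
  obtain ⟨v₁, hv₁, v₂, hv₂, hv⟩ := (one_lt_ncard_iff_nontrivial_and_finite.1 (not_le.1 h1)).1
  have : Nontrivial T := ⟨⟨⟨v₁, hv₁⟩, ⟨v₂, hv₂⟩, fun h => hv (congrArg Subtype.val h)⟩⟩
  have hinter : ∀ v w : T, v ≠ w →
      wordMap S v '' polygon A ∩ wordMap S w '' polygon A = {(y : Plane)} ∧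
        ∃ a, wordMap S v (A a) = y := fun v w hvw =>
    hS.inter_image_polygon (v.2.1.trans w.2.1.symm) (fun h => hvw (Subtype.ext h))
      (hS.mem_image_polygon hK v.2) (hS.mem_image_polygon hK w.2)
  have hμ : ∀ v : T, ∃ μ, ∀ τ, |τ| ≤ minVertexAngle A / 2 → ∃ t : ℝ, 0 < t ∧
      (y : Plane) + t • unitVector (μ + τ) ∈ wordMap S v '' polygon A := fun v => by
    obtain ⟨w, hw⟩ := exists_ne v
    obtain ⟨a, ha⟩ := (hinter v w hw.symm).2
    rw [← ha]
    exact hS.exists_arc_of_directions v a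
  choose μ hμ using hμ
  have := card_mul_lt_two_pi hpos hpi.le (fun v : T => hS.convex_image_polygon v)
    (fun v => hS.mem_image_polygon hK v.2) (fun v w hvw => (hinter v w hvw).1.subset) hμ
  rwa [← Nat.card_eq_fintype_card, Nat.card_coe_set_eq] at this

/-- A vertex, as a point of the attractor. -/
def vertexPoint (hS : IsPolygonalTreeSystem A S) (hK : IsAttractor S K) (a : Fin n) : K :=
  ⟨A a, hS.vertex_mem_attractor hK a⟩

theorem exists_arc (hS : IsPolygonalTreeSystem A S) (hK : IsAttractor S K) {a b : Fin n}
    (hab : a ≠ b) : ∃ g : C(unitInterval, Plane), Function.Injective g ∧ g 0 = A a ∧ g 1 = A b ∧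
      ∀ s, g s ∈ K :=
  (hS.isSelfSimilarTree hK).exists_arc hK.isCompact (S := wordMap S)
    (fun w x => (coe_wordComp_restrictSystem _ w x).symm)
    (injective_wordMap hS.isContractingSimilarity)
    (fun w hw => by
      obtain ⟨r, hr0, hr1, -, hr⟩ := exists_dist_wordMap_eq hS.isContractingSimilarity w
      exact ⟨r, hr0.le, hr1 hw, fun x y => (hr x y).le⟩)
    (a := hS.vertexPoint hK a) (b := hS.vertexPoint hK b) ⟨a, rfl⟩ ⟨b, rfl⟩
    fun h => hab (hS.isConvexPolygon.convexIndependent.injective (congrArg Subtype.val h))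

theorem vertex_mem_mainTree (hS : IsPolygonalTreeSystem A S) (hK : IsAttractor S K) (a : Fin n) :
    A a ∈ mainTree A K := by
  obtain ⟨h1, -, -⟩ := hS.isConvexPolygon.neighbors_ne a
  obtain ⟨g, hg, h0, hg1, hgK⟩ := hS.exists_arc hK h1.symm
  exact h0 ▸ arc_subset_mainTree h1.symm hg h0 hg1 hgK 0

/-- An arc from a vertex outside a component `D` of `K ∖ {x}` to a vertex in `D` passes through
`x`, and its final part, from `x` on, lies in `D`. -/
theorem exists_arc_through (hS : IsPolygonalTreeSystem A S) (hK : IsAttractor S K) {x : K}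
    {D : Set K} (hD : D ∈ complComponents x) {a b : Fin n} (ha : hS.vertexPoint hK a ∈ D)
    (hb : hS.vertexPoint hK b ∉ D) :
    ∃ g : C(unitInterval, Plane), (∀ s, g s ∈ mainTree A K) ∧ ∃ τ < 1, g τ = x ∧
      ∀ s, τ < s → ∃ d ∈ D, (d : Plane) = g s := by
  have hab : b ≠ a := by
    rintro rfl
    exact hb ha
  obtain ⟨g, hg, h0, h1, hgK⟩ := hS.exists_arc hK hab
  let G : unitInterval → K := fun s => ⟨g s, hgK s⟩
  have hG : Continuous G := g.continuous.subtype_mk _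
  have hG1 : G 1 ∈ D := by
    have : G 1 = hS.vertexPoint hK a := Subtype.ext h1
    exact this ▸ ha
  have hτ : ∃ τ, G τ = x := by
    by_contra! hx
    have hsub : range G ⊆ D := complComponents.subset_of_isPreconnected hD
      (isPreconnected_range hG) (by rintro ⟨τ, hτ⟩; exact hx τ hτ) (mem_range_self 1) hG1
    have : G 0 = hS.vertexPoint hK b := Subtype.ext h0
    exact hb (this ▸ hsub (mem_range_self 0))
  obtain ⟨τ, hτ⟩ := hτ
  have hGinj : Function.Injective G := fun s t hst => hg (congrArg Subtype.val hst)
  have hτ1 : τ < 1 := lt_of_le_of_ne unitInterval.le_one' fun h => by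
    rw [h] at hτ
    exact complComponents.notMem hD (hτ ▸ hG1)
  refine ⟨g, arc_subset_mainTree hab hg h0 h1 hgK, τ, hτ1, congrArg Subtype.val hτ,
    fun s hs => ⟨G s, ?_, rfl⟩⟩
  have hsub : G '' Ioc τ 1 ⊆ D := by
    refine complComponents.subset_of_isPreconnected hD
      (isPreconnected_Ioc.image G hG.continuousOn) ?_ ⟨1, ⟨hτ1, le_rfl⟩, rfl⟩ hG1
    rintro ⟨s, hs, hsx⟩
    exact hs.1.ne (hGinj (hτ.trans hsx.symm))
  exact hsub ⟨s, ⟨hs, unitInterval.le_one'⟩, rfl⟩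

/-- At a point `x` such that every component of `K ∖ {x}` contains a vertex and misses another
one, the order of the main tree is that of `K`: there is an arc of the main tree from `x` into
each component. -/
theorem mengerOrder_mainTree_eq (hS : IsPolygonalTreeSystem A S) (hK : IsAttractor S K)
    {x : K} (hx : (x : Plane) ∈ mainTree A K)
    (h1 : ∀ D ∈ complComponents x, ∃ a, hS.vertexPoint hK a ∈ D)
    (h2 : ∀ D ∈ complComponents x, ∃ b, hS.vertexPoint hK b ∉ D) :
    mengerOrder (⟨x, hx⟩ : mainTree A K) = mengerOrder x := by
  have hT := hS.isSelfSimilarTree hK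
  have : CompactSpace K := isCompact_iff_compactSpace.1 hK.isCompact
  refine le_antisymm ?_ ?_
  · exact (IsEmbedding.inclusion (mainTree_subset A K)).isInducing.mengerOrder_le
      (inclusion_injective _) ⟨x, hx⟩
  · have hN := fun k => hS.ncard_wordsThrough_le hK k x
    have : Finite (complComponents x) := hT.finite_complComponents hN
    rw [hT.mengerOrder_eq hN]
    choose a ha using fun D : complComponents x => h1 D D.2
    choose b hb using fun D : complComponents x => h2 D D.2
    choose g hgM τ hτ1 hτx hgD using fun D : complComponents x =>
      hS.exists_arc_through hK D.2 (ha D) (hb D)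
    let G : complComponents x → unitInterval → mainTree A K := fun D s => ⟨g D s, hgM D s⟩
    have hG : ∀ D, Continuous (G D) := fun D => (g D).continuous.subtype_mk _
    have hGτ : ∀ D, G D (τ D) = ⟨x, hx⟩ := fun D => Subtype.ext (hτx D)
    refine card_le_mengerOrder (C := fun D => G D '' Ioc (τ D) 1)
      (fun D => isPreconnected_Ioc.image _ (hG D).continuousOn) (fun D => ?_) (fun D => ?_)
      fun D D' z => ?_
    · rintro ⟨s, hs, hsx⟩
      obtain ⟨d, hd, hds⟩ := hgD D s hs.1
      have : d = x := Subtype.ext (hds.trans (congrArg Subtype.val hsx))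
      exact complComponents.notMem D.2 (this ▸ hd)
    · rw [← hGτ D]
      refine image_closure_subset_closure_image (hG D) (mem_image_of_mem _ ?_)
      rw [closure_Ioc (hτ1 D).ne]
      exact ⟨le_rfl, (hτ1 D).le⟩
    · rintro ⟨s, hs, rfl⟩ ⟨s', hs', hss⟩
      obtain ⟨d, hd, hds⟩ := hgD D s hs.1
      obtain ⟨d', hd', hds'⟩ := hgD D' s' hs'.1
      have : d' = d := Subtype.ext (hds'.trans ((congrArg Subtype.val hss).trans hds.symm))
      exact Subtype.ext (complComponents.eq_of_mem D.2 D'.2 hd (this ▸ hd'))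

end IsPolygonalTreeSystem

/-! ### Cut points of the attractor -/

namespace IsPolygonalTreeSystem

variable {n m : ℕ} [NeZero n] {A : Fin n → Plane} {S : Fin m → Plane → Plane} {K : Set Plane}

/-- The pieces of a large level through `y`, with the points `z i` that correspond to `y` in
them: every component of `K ∖ {z i}` contains a vertex, and the orders of `K` at the points `z i`
add up to the order at `y`. -/
theorem exists_pieces_through (hS : IsPolygonalTreeSystem A S) (hK : IsAttractor S K) (y : K) :
    ∃ k₀, ∀ k, k₀ ≤ k → ∃ (s : ℕ) (v : Fin s → List (Fin m)) (z : Fin s → K), 0 < s ∧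
      s ≤ ⌈2 * Real.pi / minVertexAngle A⌉₊ - 1 ∧ Function.Injective v ∧
      (∀ i, (v i).length = k ∧ wordComp (restrictSystem (mapsTo_attractor hK)) (v i) (z i) = y) ∧
      (∀ i, ∀ D ∈ complComponents (z i), ∃ a, hS.vertexPoint hK a ∈ D) ∧
      mengerOrder y = ∑ i, mengerOrder (z i) := by
  have hT := hS.isSelfSimilarTree hK
  have : CompactSpace K := isCompact_iff_compactSpace.1 hK.isCompact
  obtain ⟨k₀, hk₀⟩ := hT.exists_forall_mengerOrder_eq_sum
    (fun k x => hS.ncard_wordsThrough_le hK k x) y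
  refine ⟨k₀, fun k hk => ?_⟩
  set W := wordsThrough (restrictSystem (mapsTo_attractor hK)) k y with hW
  have hfin : Finite W := finite_wordsThrough _ k y
  have hne : Nonempty W := by
    obtain ⟨w, hw, x, hx⟩ := hT.exists_wordComp_eq k y
    exact ⟨⟨w, hw, x, hx⟩⟩
  let e : Fin (Nat.card W) ≃ W := (Finite.equivFin W).symm
  choose z hz using fun i => (e i).2.2
  have hv : Function.Injective fun i => (e i : List (Fin m)) :=
    Subtype.val_injective.comp e.injective
  obtain ⟨h1, h2⟩ := hk₀ k hk _ (fun i => (e i : List (Fin m))) z hv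
    (by
      change range (Subtype.val ∘ e) = W
      rw [e.surjective.range_comp, Subtype.range_val]) hz
  refine ⟨Nat.card W, fun i => e i, z, Nat.card_pos, ?_, hv, fun i => ⟨(e i).2.1, hz i⟩,
    fun i D hD => ?_, h2⟩
  · rw [Nat.card_coe_set_eq]
    exact hS.ncard_wordsThrough_le hK k y
  · obtain ⟨x, hxD, a, ha⟩ := h1 i D hD
    have : hS.vertexPoint hK a = x := Subtype.ext ha
    exact ⟨a, this ▸ hxD⟩

/-- Different components of the complement of a vertex contain different other vertices. -/
theorem mengerOrder_vertexPoint_le (hS : IsPolygonalTreeSystem A S) (hK : IsAttractor S K)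
    (c : Fin n)
    (h : ∀ D ∈ complComponents (hS.vertexPoint hK c), ∃ a, hS.vertexPoint hK a ∈ D) :
    mengerOrder (hS.vertexPoint hK c) ≤ ((n - 1 : ℕ) : ℕ∞) := by
  have : CompactSpace K := isCompact_iff_compactSpace.1 hK.isCompact
  rw [(hS.isSelfSimilarTree hK).mengerOrder_eq fun k => hS.ncard_wordsThrough_le hK k _]
  choose a ha using fun D : complComponents (hS.vertexPoint hK c) => h D D.2
  have hac : ∀ D, a D ≠ c := fun D hD => by
    have haD := ha D
    rw [hD] at haD
    exact complComponents.notMem D.2 haD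
  have hinj : Function.Injective fun D => (⟨a D, hac D⟩ : {b // b ≠ c}) := fun D D' hDD => by
    have : a D = a D' := congrArg Subtype.val hDD
    exact Subtype.ext (complComponents.eq_of_mem D.2 D'.2 (ha D) (this ▸ ha D'))
  refine (ENat.card_le_card_of_injective hinj).trans ?_
  rw [ENat.card_eq_coe_natCard, Nat.card_eq_fintype_card, Fintype.card_subtype_compl,
    Fintype.card_subtype_eq, Fintype.card_fin]

end IsPolygonalTreeSystem

theorem theorem19 {n m : ℕ} [NeZero n] (A : Fin n → Plane) (S : Fin m → Plane → Plane)
    (hS : IsPolygonalTreeSystem A S) (K : Set Plane) (hK : IsAttractor S K)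
    (y : K) (hy : IsCutPoint y) :
    (∃ w : List (Fin m), w ≠ [] ∧ ∃ x : mainTree A K, wordMap S w x = y ∧
      ((x : Plane) ∉ range A → mengerOrder y = mengerOrder x)) ∧
    (∀ w : List (Fin m), w ≠ [] → ∀ x : mainTree A K, wordMap S w x = y → (x : Plane) ∈ range A →
      ∃ (s : ℕ) (v : Fin s → List (Fin m)) (z : Fin s → mainTree A K),
        (∀ k, v k ≠ [] ∧ (z k : Plane) ∈ range A ∧ wordMap S (v k) (z k) = y) ∧
        (∀ k l, k ≠ l →
          wordMap S (v k) '' polygon A ∩ wordMap S (v l) '' polygon A = {(y : Plane)}) ∧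
        mengerOrder y = ∑ k, mengerOrder (z k) ∧
        mengerOrder y ≤ (((n - 1) * (⌈2 * Real.pi / minVertexAngle A⌉₊ - 1) : ℕ) : ℕ∞)) := by
  have hT := hS.isSelfSimilarTree hK
  have : CompactSpace K := isCompact_iff_compactSpace.1 hK.isCompact
  have hcoe := coe_wordComp_restrictSystem (IsPolygonalTreeSystem.mapsTo_attractor hK)
  have hvert : ∀ {x : K}, (x : Plane) ∈ range A → (x : Plane) ∈ mainTree A K := by
    rintro x ⟨c, hc⟩
    exact hc ▸ hS.vertex_mem_mainTree hK c
  obtain ⟨k₀, hk₀⟩ := hS.exists_pieces_through hK y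
  constructor
  · obtain ⟨s, v, z, hs, -, hv, hvz, hz, hsum⟩ := hk₀ (max k₀ 1) (le_max_left _ _)
    have hne : v ⟨0, hs⟩ ≠ [] := fun h => by
      have := (hvz ⟨0, hs⟩).1
      rw [h, List.length_nil] at this
      omega
    have hmap : wordMap S (v ⟨0, hs⟩) (z ⟨0, hs⟩) = y := by rw [← hcoe, (hvz _).2]
    refine ⟨v ⟨0, hs⟩, hne, ?_⟩
    by_cases hx : (z ⟨0, hs⟩ : Plane) ∈ range A
    · exact ⟨⟨z ⟨0, hs⟩, hvert hx⟩, hmap, fun h => absurd hx h⟩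
    -- A point that is not the image of a vertex lies in only one piece of each level.
    have huniq : ∀ i : Fin s, i = ⟨0, hs⟩ := fun i => by
      by_contra hi
      exact hx (hT.mem_of_wordComp_eq ((hvz ⟨0, hs⟩).1.trans (hvz i).1.symm)
        (fun h => hi (hv h).symm) ((hvz _).2.trans (hvz i).2.symm))
    have hord : mengerOrder y = mengerOrder (z ⟨0, hs⟩) := by
      rw [hsum]
      exact Fintype.sum_eq_single _ fun i hi => absurd (huniq i) hi
    have h2 : 2 ≤ (complComponents (z ⟨0, hs⟩)).encard := by
      rw [← hT.mengerOrder_eq fun k => hS.ncard_wordsThrough_le hK k _, ← hord,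
        hT.mengerOrder_eq fun k => hS.ncard_wordsThrough_le hK k _]
      exact complComponents.two_le_encard hy
    have hmiss : ∀ D ∈ complComponents (z ⟨0, hs⟩), ∃ b, hS.vertexPoint hK b ∉ D := by
      intro D hD
      obtain ⟨D', hD', hDD⟩ := (one_lt_encard_iff_nontrivial.1
        (lt_of_lt_of_le (by norm_num) h2)).exists_ne D
      obtain ⟨b, hb⟩ := hz _ D' hD'
      exact ⟨b, fun hbD => hDD (complComponents.eq_of_mem hD' hD hb hbD)⟩
    have hmem : (z ⟨0, hs⟩ : Plane) ∈ mainTree A K := by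
      obtain ⟨D, hD⟩ : (complComponents (z ⟨0, hs⟩)).Nonempty := by
        rw [← encard_pos]
        exact lt_of_lt_of_le (by norm_num) h2
      obtain ⟨a, ha⟩ := hz _ D hD
      obtain ⟨b, hb⟩ := hmiss D hD
      obtain ⟨g, hg, τ, -, hτ, -⟩ := hS.exists_arc_through hK hD ha hb
      exact hτ ▸ hg τ
    exact ⟨⟨z ⟨0, hs⟩, hmem⟩, hmap, fun _ => by
      rw [hord, hS.mengerOrder_mainTree_eq hK hmem (hz _) hmiss]⟩
  · intro w hw x hwx hx
    obtain ⟨s, v, z, -, hsN, hv, hvz, hz, hsum⟩ :=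
      hk₀ (max k₀ w.length) (le_max_left _ _)
    have hmap : ∀ i, wordMap S (v i) (z i) = y := fun i => by rw [← hcoe, (hvz i).2]
    have hne : ∀ i, v i ≠ [] := fun i h => by
      have h1 := (hvz i).1
      have h2 := List.length_pos_iff.2 hw
      rw [h, List.length_nil] at h1
      omega
    -- As `y` is a vertex of a piece of level `w.length`, it is a vertex of all deeper pieces.
    have hzA : ∀ i, (z i : Plane) ∈ range A := fun i => by
      have hlen : ((v i).take w.length).length = w.length := by
        rw [List.length_take, (hvz i).1]
        omega
      have hxK : wordComp (restrictSystem (IsPolygonalTreeSystem.mapsTo_attractor hK)) w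
          ⟨x, mainTree_subset A K x.2⟩ = y := Subtype.ext (by rw [hcoe]; exact hwx)
      have hvi := (hvz i).2
      rw [← List.take_append_drop w.length (v i), wordComp_append, Function.comp_apply] at hvi
      refine hT.mem_of_wordComp_mem (w := (v i).drop w.length) (x := z i) ?_
      by_cases heq : (v i).take w.length = w
      · rw [heq] at hvi
        rw [hT.injective_wordComp w (hvi.trans hxK.symm)]
        exact hx
      · exact hT.mem_of_wordComp_eq hlen heq (hvi.trans hxK.symm)
    have hmiss : ∀ i, ∀ D ∈ complComponents (z i), ∃ b, hS.vertexPoint hK b ∉ D := by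
      intro i D hD
      obtain ⟨c, hc⟩ := hzA i
      have : hS.vertexPoint hK c = z i := Subtype.ext hc
      exact ⟨c, fun h => complComponents.notMem hD (this ▸ h)⟩
    refine ⟨s, v, fun i => ⟨z i, hvert (hzA i)⟩, fun i => ⟨hne i, hzA i, hmap i⟩,
      fun i j hij => ?_, ?_, ?_⟩
    · have hy : ∀ i, (y : Plane) ∈ wordMap S (v i) '' polygon A := fun i =>
        ⟨z i, hS.attractor_subset_polygon hK (z i).2, hmap i⟩
      exact (hS.inter_image_polygon ((hvz i).1.trans (hvz j).1.symm) (fun h => hij (hv h))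
        (hy i) (hy j)).1
    · rw [hsum]
      exact Finset.sum_congr rfl fun i _ =>
        (hS.mengerOrder_mainTree_eq hK (hvert (hzA i)) (hz i) (hmiss i)).symm
    · have hle : ∀ i, mengerOrder (z i) ≤ ((n - 1 : ℕ) : ℕ∞) := fun i => by
        obtain ⟨c, hc⟩ := hzA i
        have hzc : z i = hS.vertexPoint hK c := Subtype.ext hc.symm
        have h := hz i
        rw [hzc] at h ⊢
        exact hS.mengerOrder_vertexPoint_le hK c h
      rw [hsum]
      refine (Finset.sum_le_sum fun i _ => hle i).trans ?_
      rw [Finset.sum_const, Finset.card_univ, Fintype.card_fin, nsmul_eq_mul, mul_comm]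
      exact_mod_cast Nat.mul_le_mul_left _ hsN
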